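/- Let $P:\mathbb R\to\mathbb R$ be an even convex function with $\lim_{u\to0}P(u)/u=0$ and $\lim_{u\to\infty}P(u)/u=\infty$, and let $Q(v):=\sup_{u\in\mathbb R}\{u|v|-P(u)\}$ be its convex conjugate. Let $(\Omega,\mathcal M,\mu)$ be a semifinite measure space, that is, every measurable set of infinite measure contains a measurable subset of positive finite measure. Functions on $\Omega$ are real-valued and measurable, and functions that are equal $\mu$-almost everywhere are identified. Let $L^P$ be the space of all $f$ such that $fg$ is integrable whenever $\int_\Omega Q(g)\,d\mu<\infty$, and let $L^Q$ be the space of all $g$ such that $fg$ is integrable whenever $\int_\Omega P(f)\,d\mu<\infty$. Endow $L^P$ with the Luxemburg norm and $L^Q$ with the Orlicz norm $$\|f\|_{P,\mathrm{Lux}}:=\inf\Bigl\{k>0:\int_\Omega P(k^{-1}f)\,d\mu\le1\Bigr\},\qquad \|g\|_{Q,\mathrm{Orl}}:=\sup\Bigl\{\int_\Omega fg\,d\mu:\int_\Omega P(f)\,d\mu\le1\Bigr\}.$$ Assume that $P$ is differentiable and satisfies the following conditions: (i) there exists a constant $\alpha$ such that $P(2u)\le\alpha P(u)$ for all $u\in\mathbb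 R$; (ii) for each $\varepsilon>0$ there exists a $\rho(\varepsilon)>0$ such that, for all $u,v\in\mathbb R$, $$|u-v|\ge\varepsilon(|u|+|v|)\ \Longrightarrow\ \frac{P(u)+P(v)}2-P\Bigl(\frac{u+v}2\Bigr)\ge\rho(\varepsilon)\,\frac{P(u)+P(v)}2 .$$ Then the two formulas above define norms on $L^P$ and $L^Q$, the product $fg$ is integrable for all $f\in L^P$ and $g\in L^Q$, and the formula $\Phi(g)(f):=\int_\Omega fg\,d\mu$ defines a linear isometric isomorphism $\Phi$ of $L^Q$ onto the dual space $(L^P)'$. -/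

import Mathlib

open MeasureTheory Filter Topology

noncomputable section

/-- A measure is semifinite if every measurable set of infinite measure contains a measurable
subset of positive finite measure. -/
def IsSemifinite {Ω : Type*} [MeasurableSpace Ω] (μ : Measure Ω) : Prop :=
  ∀ s : Set Ω, MeasurableSet s → μ s = ⊤ →
    ∃ t : Set Ω, t ⊆ s ∧ MeasurableSet t ∧ 0 < μ t ∧ μ t < ⊤

/-- Even convex functions `P : ℝ → ℝ` with `P u / u → 0` as `u → 0` and `P u / u → ∞` as
`u → ∞`. (Such a function is nonnegative and vanishes at `0`.) -/
structure IsNFunction (P : ℝ → ℝ) : Prop where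
  even : Function.Even P
  convexOn : ConvexOn ℝ Set.univ P
  tendsto_zero : Tendsto (fun u => P u / u) (𝓝[≠] 0) (𝓝 0)
  tendsto_atTop : Tendsto (fun u => P u / u) atTop atTop

/-- The convex conjugate `Q v = sup_u (u * |v| - P u)`. For an `IsNFunction` the supremum is over
a set which is bounded above. -/
def convexConjugate (P : ℝ → ℝ) (v : ℝ) : ℝ :=
  ⨆ u : ℝ, (u * |v| - P u)

section Spaces

variable {Ω : Type*} [MeasurableSpace Ω]

/-- The modular `∫ R(f) dμ ∈ [0, ∞]` of a function `f`, for a nonnegative `R`. -/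
def modular (R : ℝ → ℝ) (μ : Measure Ω) (f : Ω → ℝ) : ENNReal :=
  ∫⁻ x, ENNReal.ofReal (R (f x)) ∂μ

/-- The (a.e. classes of) measurable functions `f` such that `f * g` is integrable for every
measurable `g` with `∫ R(g) dμ < ∞`. -/
def associateSpace (R : ℝ → ℝ) (μ : Measure Ω) : Submodule ℝ (Ω →ₘ[μ] ℝ) where
  carrier := {f | ∀ g : Ω → ℝ, Measurable g → modular R μ g < ⊤ →
    Integrable (fun x => f x * g x) μ}
  zero_mem' := by
    intro g _ _
    refine (integrable_zero Ω ℝ μ).congr ?_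
    filter_upwards [AEEqFun.coeFn_zero (α := Ω) (β := ℝ) (μ := μ)] with x hx
    simp [hx]
  add_mem' := by
    intro f₁ f₂ h₁ h₂ g hg hgm
    refine ((h₁ g hg hgm).add (h₂ g hg hgm)).congr ?_
    filter_upwards [AEEqFun.coeFn_add f₁ f₂] with x hx
    simp [hx, add_mul]
  smul_mem' := by
    intro c f hf g hg hgm
    refine ((hf g hg hgm).const_mul c).congr ?_
    filter_upwards [AEEqFun.coeFn_smul c f] with x hx
    simp [hx, mul_assoc]

/-- The Orlicz space `L^P`, to be normed by the Luxemburg norm: `f ∈ L^P` iff `f * g` is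
integrable whenever `∫ Q(g) dμ < ∞`, with `Q` the convex conjugate of `P`. -/
def LuxemburgSpace (P : ℝ → ℝ) (μ : Measure Ω) : Type _ :=
  associateSpace (convexConjugate P) μ

/-- The Orlicz space `L^Q`, `Q` the convex conjugate of `P`, to be normed by the Orlicz norm:
`g ∈ L^Q` iff `f * g` is integrable whenever `∫ P(f) dμ < ∞`. -/
def ConjugateOrliczSpace (P : ℝ → ℝ) (μ : Measure Ω) : Type _ :=
  associateSpace P μ

namespace LuxemburgSpace

variable (P : ℝ → ℝ) (μ : Measure Ω)

instance : AddCommGroup (LuxemburgSpace P μ) :=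
  inferInstanceAs (AddCommGroup (associateSpace (convexConjugate P) μ))

instance : Module ℝ (LuxemburgSpace P μ) :=
  inferInstanceAs (Module ℝ (associateSpace (convexConjugate P) μ))

instance : CoeFun (LuxemburgSpace P μ) (fun _ => Ω → ℝ) where
  coe f := ((f.1 : Ω →ₘ[μ] ℝ) : Ω → ℝ)

/-- The Luxemburg norm `inf {k > 0 : ∫ P(f / k) dμ ≤ 1}`. -/
instance : Norm (LuxemburgSpace P μ) where
  norm f := sInf {k : ℝ | 0 < k ∧ modular P μ (fun x => k⁻¹ * f x) ≤ 1}

end LuxemburgSpace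

namespace ConjugateOrliczSpace

variable (P : ℝ → ℝ) (μ : Measure Ω)

instance : AddCommGroup (ConjugateOrliczSpace P μ) :=
  inferInstanceAs (AddCommGroup (associateSpace P μ))

instance : Module ℝ (ConjugateOrliczSpace P μ) :=
  inferInstanceAs (Module ℝ (associateSpace P μ))

instance : CoeFun (ConjugateOrliczSpace P μ) (fun _ => Ω → ℝ) where
  coe g := ((g.1 : Ω →ₘ[μ] ℝ) : Ω → ℝ)

/-- The Orlicz norm `sup {∫ f g dμ : ∫ P(f) dμ ≤ 1}`. The integrals exist by the definition of
the space. -/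
instance : Norm (ConjugateOrliczSpace P μ) where
  norm g := sSup {r : ℝ | ∃ f : Ω → ℝ, Measurable f ∧ modular P μ f ≤ 1 ∧
    r = ∫ x, f x * g x ∂μ}

end ConjugateOrliczSpace

end Spaces

end

/-! The dual is computed by the direct method, so neither Radon–Nikodym nor σ-finiteness is needed.
Given a bounded functional `φ` on `L^P`, minimise `J f = ∫ P(f) dμ - φ f`. At a minimiser `f` the
derivative of `J` in every direction `h` vanishes, that is, `φ h = ∫ P'(f) h dμ`. So `P'(f)`
represents `φ`, and it lies in `L^Q` because its products with all `h` of finite modular are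
integrable (`hasDerivAt_integral_comp`).

A minimiser exists (`exists_isMinOn`) for three reasons. Uniform convexity makes the modular
superlinear in the norm, so `J` is bounded below and minimising sequences have bounded modular. It
also turns a small midpoint defect into a small modular of the difference (`map_half_sub_le`), so
minimising sequences are Cauchy in modular. Doubling makes modular convergence complete
(`exists_tendsto_of_modular_cauchy`) and strong enough for `φ` to pass to the limit; Fatou handles
the modular.

All this needs every `f ∈ L^P` to have finite modular, although `L^P` is defined by integrability of
products (`modular_lt_top_of_integrable_mul`). If `∫ P(f) dμ = ∞`, a suitable multiple of `P'(f)` on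
a set where the integral is large but finite violates uniform boundedness. Semifiniteness provides
this set, and it also makes the Orlicz norm definite.

The isometry is then Hölder's inequality in one direction; in the other, the modular unit ball lies
in the Luxemburg unit ball. -/

/-- Even convex functions `R : ℝ → ℝ` with `R 0 = 0` that grow at least linearly at infinity. -/
structure IsYoungFunction (R : ℝ → ℝ) : Prop where
  even : Function.Even R
  convexOn : ConvexOn ℝ Set.univ R
  map_zero : R 0 = 0
  coercive : ∃ a : ℝ, 0 < a ∧ ∃ b : ℝ, ∀ v, a * |v| ≤ R v + b

/-! ### Scalar inequalities for Young functions. -/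

namespace IsYoungFunction

variable {R : ℝ → ℝ} (hR : IsYoungFunction R)
include hR
theorem nonneg (v : ℝ) : 0 ≤ R v := by
  have h := hR.convexOn.2 (Set.mem_univ v) (Set.mem_univ (-v))
    (show (0 : ℝ) ≤ 1 / 2 by norm_num) (show (0 : ℝ) ≤ 1 / 2 by norm_num) (by norm_num)
  have h0 : (1 / 2 : ℝ) • v + (1 / 2 : ℝ) • (-v) = 0 := by simp
  rw [h0, hR.map_zero, hR.even v, smul_eq_mul] at h
  linarith

theorem continuous : Continuous R :=
  continuousOn_univ.1 (hR.convexOn.continuousOn isOpen_univ)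

theorem measurable : Measurable R := hR.continuous.measurable

theorem map_mul_le {t : ℝ} (h0 : 0 ≤ t) (h1 : t ≤ 1) (v : ℝ) : R (t * v) ≤ t * R v := by
  have h := hR.convexOn.2 (Set.mem_univ v) (Set.mem_univ 0) h0 (sub_nonneg.2 h1) (by ring)
  simpa [hR.map_zero] using h

theorem map_abs (v : ℝ) : R |v| = R v := by
  rcases abs_choice v with h | h <;> rw [h]
  exact hR.even v

theorem map_le_of_abs_le {u v : ℝ} (h : |u| ≤ |v|) : R u ≤ R v := by
  rcases eq_or_ne v 0 with rfl | hv
  · have : u = 0 := by simpa using h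
    rw [this]
  · have hv' : 0 < |v| := abs_pos.2 hv
    have h1 := hR.map_mul_le (t := |u| / |v|) (by positivity) ((div_le_one hv').2 h) |v|
    rw [div_mul_cancel₀ _ hv'.ne', hR.map_abs, hR.map_abs] at h1
    refine h1.trans (mul_le_of_le_one_left (hR.nonneg v) ((div_le_one hv').2 h))

theorem mul_map_le {t : ℝ} (h1 : 1 ≤ t) (v : ℝ) : t * R v ≤ R (t * v) := by
  have ht : 0 < t := by linarith
  have h := hR.map_mul_le (t := t⁻¹) (by positivity) (inv_le_one_of_one_le₀ h1) (t * v)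
  rw [inv_mul_cancel_left₀ ht.ne'] at h
  calc t * R v ≤ t * (t⁻¹ * R (t * v)) := by gcongr
    _ = R (t * v) := mul_inv_cancel_left₀ ht.ne' _

theorem map_convexComb_le {a b : ℝ} (ha : 0 ≤ a) (hb : 0 ≤ b) (hab : a + b = 1) (u v : ℝ) :
    R (a * u + b * v) ≤ a * R u + b * R v := by
  simpa using hR.convexOn.2 (Set.mem_univ u) (Set.mem_univ v) ha hb hab

theorem map_half_add_le (u v : ℝ) : R ((u + v) / 2) ≤ (R u + R v) / 2 := by
  have h := hR.map_convexComb_le (a := 1 / 2) (b := 1 / 2) (by norm_num) (by norm_num)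
    (by norm_num) u v
  have e : (u + v) / 2 = 1 / 2 * u + 1 / 2 * v := by ring
  rw [e]
  linarith

/-- Coercivity forbids zeros along an unbounded sequence. A Young function may vanish near `0`; with
doubling, one nonzero zero would propagate to all `2 ^ n * u`, so this lemma yields definiteness. -/
theorem eq_zero_of_forall_mul {u : ℝ} (h : ∀ n : ℕ, R (2 ^ n * u) = 0) : u = 0 := by
  obtain ⟨a, ha, b, hab⟩ := hR.coercive
  by_contra hu
  obtain ⟨n, hn⟩ := pow_unbounded_of_one_lt (b / (a * |u|)) (one_lt_two (α := ℝ))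
  have hpos : 0 < a * |u| := mul_pos ha (abs_pos.2 hu)
  have h1 := hab (2 ^ n * u)
  rw [h n, abs_mul, abs_of_pos (by positivity : (0 : ℝ) < 2 ^ n)] at h1
  rw [div_lt_iff₀ hpos] at hn
  nlinarith

/-- Convexity with weights `2 ^ (-(i + 1))`, the missing weight sitting at `0`. The induction splits
off the first term by a midpoint and doubles the tail. -/
theorem sum_le (d : ℕ → ℝ) (n : ℕ) :
    R (∑ i ∈ Finset.range n, d i) ≤ ∑ i ∈ Finset.range n, R (2 ^ (i + 1) * d i) := by
  induction n generalizing d with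
  | zero => simp [hR.map_zero]
  | succ n ih =>
    rw [Finset.sum_range_succ', Finset.sum_range_succ']
    have h1 := hR.map_half_add_le (2 * ∑ i ∈ Finset.range n, d (i + 1)) (2 * d 0)
    have h2 := ih (fun i => 2 * d (i + 1))
    rw [← Finset.mul_sum] at h2
    have h3 : ∀ i, (2 : ℝ) ^ (i + 1) * (2 * d (i + 1)) = 2 ^ (i + 1 + 1) * d (i + 1) :=
      fun i => by ring
    simp only [h3] at h2
    have h4 : (2 * ∑ i ∈ Finset.range n, d (i + 1) + 2 * d 0) / 2
        = ∑ i ∈ Finset.range n, d (i + 1) + d 0 := by ring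
    rw [h4] at h1
    have h5 := hR.nonneg (2 * ∑ i ∈ Finset.range n, d (i + 1))
    have h6 := hR.nonneg (2 * d 0)
    simp only [zero_add, pow_one]
    linarith

end IsYoungFunction

/-! ### The convex conjugate, and scalar consequences of doubling and uniform convexity. -/

namespace IsNFunction

variable {P : ℝ → ℝ} (hP : IsNFunction P)
include hP

theorem isYoungFunction : IsYoungFunction P := by
  have hcont : Continuous P := continuousOn_univ.1 (hP.convexOn.continuousOn isOpen_univ)
  have h0 : P 0 = 0 := by
    have h1 : Tendsto (fun u => P u / u * u) (𝓝[≠] 0) (𝓝 (0 * 0)) :=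
      hP.tendsto_zero.mul (tendsto_nhdsWithin_of_tendsto_nhds tendsto_id)
    have h2 : Tendsto P (𝓝[≠] 0) (𝓝 (0 * 0)) := by
      refine h1.congr' ?_
      filter_upwards [self_mem_nhdsWithin] with u hu
      exact div_mul_cancel₀ _ hu
    simpa using tendsto_nhds_unique ((hcont.tendsto 0).mono_left nhdsWithin_le_nhds) h2
  refine ⟨hP.even, hP.convexOn, h0, 1, one_pos, ?_⟩
  have hnn : ∀ v, 0 ≤ P v := fun v => by
    have h := hP.convexOn.2 (Set.mem_univ v) (Set.mem_univ (-v))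
      (show (0 : ℝ) ≤ 1 / 2 by norm_num) (show (0 : ℝ) ≤ 1 / 2 by norm_num) (by norm_num)
    have h0' : (1 / 2 : ℝ) • v + (1 / 2 : ℝ) • (-v) = 0 := by simp
    rw [h0', h0, hP.even v, smul_eq_mul] at h
    linarith
  obtain ⟨M, hM⟩ := (hP.tendsto_atTop.eventually_ge_atTop 1).exists_forall_of_atTop
  refine ⟨max M 0, fun v => ?_⟩
  rcases le_or_gt |v| (max M 0) with h | h
  · linarith [hnn v]
  · have hv : 0 < |v| := (le_max_right _ _).trans_lt h
    have h1 := hM |v| ((le_max_left _ _).trans h.le)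
    rw [le_div_iff₀ hv] at h1
    have h2 : P |v| = P v := by
      rcases abs_choice v with h | h <;> rw [h]
      exact hP.even v
    linarith [le_max_right M 0]

theorem bddAbove_conjugate (v : ℝ) : BddAbove (Set.range fun u : ℝ => u * |v| - P u) := by
  have hY := hP.isYoungFunction
  obtain ⟨M, hM⟩ := (hP.tendsto_atTop.eventually_ge_atTop |v|).exists_forall_of_atTop
  refine ⟨max M 0 * |v|, ?_⟩
  rintro _ ⟨u, rfl⟩
  have hn := hY.nonneg u
  have hv := abs_nonneg v
  simp only
  rcases le_or_gt u (max M 0) with h | h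
  · nlinarith
  · have hu : 0 < u := (le_max_right _ _).trans_lt h
    have h1 := hM u ((le_max_left _ _).trans h.le)
    rw [le_div_iff₀ hu] at h1
    have : 0 ≤ max M 0 * |v| := by positivity
    nlinarith

theorem mul_abs_sub_le_conjugate (u v : ℝ) : u * |v| - P u ≤ convexConjugate P v :=
  le_ciSup (hP.bddAbove_conjugate v) u

theorem conjugate_nonneg (v : ℝ) : 0 ≤ convexConjugate P v := by
  simpa [hP.isYoungFunction.map_zero] using hP.mul_abs_sub_le_conjugate 0 v

theorem young_inequality (u v : ℝ) : |u * v| ≤ P u + convexConjugate P v := by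
  have h := hP.mul_abs_sub_le_conjugate |u| v
  rw [hP.isYoungFunction.map_abs] at h
  rw [abs_mul]
  linarith

theorem isYoungFunction_conjugate : IsYoungFunction (convexConjugate P) where
  even v := by simp [convexConjugate]
  convexOn := by
    refine ⟨convex_univ, fun v _ w _ a b ha hb hab => ciSup_le fun u => ?_⟩
    simp only [smul_eq_mul]
    have hv := hP.mul_abs_sub_le_conjugate u v
    have hw := hP.mul_abs_sub_le_conjugate u w
    have hv0 := hP.conjugate_nonneg v
    have hw0 := hP.conjugate_nonneg w
    rcases le_total 0 u with hu | hu
    · have h1 : |a * v + b * w| ≤ a * |v| + b * |w| := by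
        refine (abs_add_le _ _).trans_eq ?_
        rw [abs_mul, abs_mul, abs_of_nonneg ha, abs_of_nonneg hb]
      calc u * |a * v + b * w| - P u ≤ u * (a * |v| + b * |w|) - (a + b) * P u := by
            rw [hab, one_mul]; gcongr
        _ = a * (u * |v| - P u) + b * (u * |w| - P u) := by ring
        _ ≤ _ := by gcongr
    · have h1 : u * |a * v + b * w| ≤ 0 := mul_nonpos_of_nonpos_of_nonneg hu (abs_nonneg _)
      have h2 := hP.isYoungFunction.nonneg u
      have : 0 ≤ a * convexConjugate P v + b * convexConjugate P w := by positivity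
      linarith
  map_zero := by
    refine le_antisymm (ciSup_le fun u => ?_) (hP.conjugate_nonneg 0)
    simpa using hP.isYoungFunction.nonneg u
  coercive := ⟨1, one_pos, P 1, fun v => by linarith [hP.mul_abs_sub_le_conjugate 1 v]⟩

/-- Doubling dualised by testing the supremum for `v` at `2 * w`. Compared with the factor `2 / α`
that convexity alone would give, this gains a factor `2`. -/
theorem conjugate_two_div_mul_le {α : ℝ} (hα : 0 < α) (hd : ∀ u, P (2 * u) ≤ α * P u) (v : ℝ) :
    convexConjugate P (2 / α * v) ≤ convexConjugate P v / α := by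
  refine ciSup_le fun w => ?_
  have h1 := hP.mul_abs_sub_le_conjugate (2 * w) v
  have h2 := hd w
  rw [le_div_iff₀ hα, abs_mul, abs_of_pos (by positivity : 0 < 2 / α)]
  have h3 : (w * (2 / α * |v|) - P w) * α = 2 * w * |v| - α * P w := by field_simp
  linarith

theorem conjugate_two_div_pow_mul_le {α : ℝ} (hα : 0 < α) (hd : ∀ u, P (2 * u) ≤ α * P u)
    (n : ℕ) (v : ℝ) :
    convexConjugate P ((2 / α) ^ n * v) ≤ (1 / α) ^ n * convexConjugate P v := by
  induction n generalizing v with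
  | zero => simp
  | succ n ih =>
    calc convexConjugate P ((2 / α) ^ (n + 1) * v)
        = convexConjugate P ((2 / α) ^ n * (2 / α * v)) := by ring_nf
      _ ≤ (1 / α) ^ n * convexConjugate P (2 / α * v) := ih _
      _ ≤ (1 / α) ^ n * (convexConjugate P v / α) := by
          gcongr; exact hP.conjugate_two_div_mul_le hα hd v
      _ = _ := by ring

/-- Comparing `2 * u` with `0` in the uniform convexity condition improves `2 P(u) ≤ P(2u)` by a
factor `1 + ρ`. Iterating makes the factor exceed any `K`, uniformly in `u`. -/
theorem superlinear
    (hconv : ∀ ε : ℝ, 0 < ε → ∃ ρ : ℝ, 0 < ρ ∧ ∀ u v : ℝ, ε * (|u| + |v|) ≤ |u - v| →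
      ρ * ((P u + P v) / 2) ≤ (P u + P v) / 2 - P ((u + v) / 2)) (K : ℝ) :
    ∃ s₀ : ℝ, 1 ≤ s₀ ∧ ∀ s, s₀ ≤ s → ∀ u, K * s * P u ≤ P (s * u) := by
  have hY := hP.isYoungFunction
  obtain ⟨ρ, hρ, h⟩ := hconv 1 one_pos
  have h2 : ∀ u, (1 + ρ) * (2 * P u) ≤ P (2 * u) := fun u => by
    have h3 := h (2 * u) 0 (by simp)
    rw [hY.map_zero] at h3
    simp only [add_zero] at h3
    rw [mul_div_cancel_left₀ u two_ne_zero] at h3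
    have h4 := hY.nonneg (2 * u)
    have h5 := hY.nonneg u
    -- From `P u ≤ (1 - ρ) P(2u) / 2`, multiplied by `1 + ρ`, using `1 - ρ² ≤ 1`.
    nlinarith [mul_le_mul_of_nonneg_left (show P u ≤ (1 - ρ) * (P (2 * u) / 2) by linarith)
      (by linarith : 0 ≤ 1 + ρ), mul_nonneg (sq_nonneg ρ) h4]
  have hn : ∀ (n : ℕ) (u : ℝ), (1 + ρ) ^ n * (2 ^ n * P u) ≤ P (2 ^ n * u) := by
    intro n
    induction n with
    | zero => simp
    | succ n ih =>
      intro u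
      calc (1 + ρ) ^ (n + 1) * (2 ^ (n + 1) * P u)
          = (1 + ρ) * (2 * ((1 + ρ) ^ n * (2 ^ n * P u))) := by ring
        _ ≤ (1 + ρ) * (2 * P (2 ^ n * u)) := by gcongr; exact ih u
        _ ≤ P (2 * (2 ^ n * u)) := h2 _
        _ = _ := by ring_nf
  obtain ⟨n, hKn⟩ := pow_unbounded_of_one_lt K (by linarith : 1 < 1 + ρ)
  refine ⟨2 ^ n, one_le_pow₀ one_le_two, fun s hs u => ?_⟩
  have h2n : (0 : ℝ) < 2 ^ n := by positivity
  have hs0 : 0 < s := h2n.trans_le hs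
  calc K * s * P u ≤ (1 + ρ) ^ n * s * P u := by
        have := hY.nonneg u
        gcongr
    _ = s / 2 ^ n * ((1 + ρ) ^ n * (2 ^ n * P u)) := by field_simp
    _ ≤ s / 2 ^ n * P (2 ^ n * u) := by gcongr; exact hn n u
    _ ≤ P (s / 2 ^ n * (2 ^ n * u)) := hY.mul_map_le ((one_le_div h2n).2 hs) _
    _ = P (s * u) := by congr 1; field_simp

variable (hdiff : Differentiable ℝ P)
include hdiff

theorem add_deriv_mul_le (u w : ℝ) : P u + deriv P u * (w - u) ≤ P w := by
  rcases lt_trichotomy u w with h | rfl | h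
  · have := hP.convexOn.deriv_le_slope (Set.mem_univ u) (Set.mem_univ w) h (hdiff u)
    rw [slope_def_field, le_div_iff₀ (by linarith)] at this
    linarith
  · simp
  · have := hP.convexOn.slope_le_deriv (Set.mem_univ w) (Set.mem_univ u) h (hdiff u)
    rw [slope_def_field, div_le_iff₀ (by linarith)] at this
    linarith

theorem le_mul_deriv (u : ℝ) : P u ≤ u * deriv P u := by
  have := hP.add_deriv_mul_le hdiff u 0
  rw [hP.isYoungFunction.map_zero] at this
  linarith

/-- The tangent at `u` bounds the supremum by `u P'(u) - P u`, and the same tangent evaluated at `2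
* u` bounds `u P'(u)` by `P(2u) - P u`. -/
theorem conjugate_deriv_le {α : ℝ} (hd : ∀ u, P (2 * u) ≤ α * P u) (u : ℝ) :
    convexConjugate P (deriv P u) ≤ α * P u := by
  refine ciSup_le fun w => ?_
  have h1 := hP.add_deriv_mul_le hdiff u (2 * u)
  have h2 := hd u
  have h3 := hP.isYoungFunction.nonneg u
  rcases abs_choice (deriv P u) with h | h <;> rw [h]
  · have := hP.add_deriv_mul_le hdiff u w
    linarith
  · have := hP.add_deriv_mul_le hdiff u (-w)
    rw [hP.even w] at this
    linarith

end IsNFunction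

/-! ### The modular: summable series and uniform boundedness. -/

section Modular

variable {Ω : Type*} [MeasurableSpace Ω] {μ : Measure Ω}

theorem modular_congr_ae {R : ℝ → ℝ} {f g : Ω → ℝ} (h : f =ᵐ[μ] g) :
    modular R μ f = modular R μ g :=
  lintegral_congr_ae (h.mono fun x hx => by simp only [hx])

namespace IsYoungFunction

variable {R : ℝ → ℝ} (hR : IsYoungFunction R)
include hR

theorem measurable_ofReal_comp {f : Ω → ℝ} (hf : Measurable f) :
    Measurable fun x => ENNReal.ofReal (R (f x)) :=
  (hR.measurable.comp hf).ennreal_ofReal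

theorem modular_mono {f g : Ω → ℝ} (h : ∀ x, |f x| ≤ |g x|) : modular R μ f ≤ modular R μ g :=
  lintegral_mono fun x => ENNReal.ofReal_le_ofReal (hR.map_le_of_abs_le (h x))

theorem modular_mul_le {t : ℝ} (h0 : 0 ≤ t) (h1 : t ≤ 1) (f : Ω → ℝ) :
    modular R μ (fun x => t * f x) ≤ ENNReal.ofReal t * modular R μ f := by
  rw [modular, modular, ← lintegral_const_mul' _ _ ENNReal.ofReal_ne_top]
  refine lintegral_mono fun x => ?_
  rw [← ENNReal.ofReal_mul h0]
  exact ENNReal.ofReal_le_ofReal (hR.map_mul_le h0 h1 _)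

/-- A Riesz–Fischer argument. Where the sum of the integrands is finite, coercivity bounds `|d n x|`
by a constant times `2 ^ (-(n + 1))`, so the series converges; `sum_le` and continuity bound the
modular of the sum. -/
theorem exists_hasSum_of_tsum_modular {d : ℕ → Ω → ℝ} (hd : ∀ n, Measurable (d n))
    (h : ∑' n, modular R μ (fun x => 2 ^ (n + 1) * d n x) ≠ ⊤) :
    ∃ f : Ω → ℝ, Measurable f ∧ (∀ᵐ x ∂μ, HasSum (fun n => d n x) (f x)) ∧
      modular R μ f ≤ ∑' n, modular R μ (fun x => 2 ^ (n + 1) * d n x) := by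
  have hm : ∀ n, Measurable fun x => ENNReal.ofReal (R (2 ^ (n + 1) * d n x)) := fun n =>
    hR.measurable_ofReal_comp ((hd n).const_mul _)
  have hS : ∑' n, modular R μ (fun x => 2 ^ (n + 1) * d n x)
      = ∫⁻ x, ∑' n, ENNReal.ofReal (R (2 ^ (n + 1) * d n x)) ∂μ :=
    (lintegral_tsum fun n => (hm n).aemeasurable).symm
  rw [hS] at h ⊢
  have hfin := ae_lt_top (Measurable.tsum hm) h
  obtain ⟨a, ha, b, hab⟩ := hR.coercive
  have hsum : ∀ᵐ x ∂μ, Summable fun n => d n x := by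
    filter_upwards [hfin] with x hx
    refine Summable.of_norm_bounded (g := fun n : ℕ =>
      (((∑' n, ENNReal.ofReal (R (2 ^ (n + 1) * d n x))).toReal + b) / a) * (1 / 2) ^ (n + 1)) ?_
      fun n => ?_
    · exact ((summable_nat_add_iff 1).2 summable_geometric_two).mul_left _
    · have h1 : R (2 ^ (n + 1) * d n x)
          ≤ (∑' n, ENNReal.ofReal (R (2 ^ (n + 1) * d n x))).toReal := by
        rw [← ENNReal.ofReal_le_iff_le_toReal hx.ne]
        exact ENNReal.le_tsum (f := fun n => ENNReal.ofReal (R (2 ^ (n + 1) * d n x))) n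
      have h2 := hab (2 ^ (n + 1) * d n x)
      rw [abs_mul, abs_of_pos (by positivity : (0 : ℝ) < 2 ^ (n + 1))] at h2
      rw [Real.norm_eq_abs, one_div, inv_pow, ← div_eq_mul_inv, le_div_iff₀ (by positivity),
        le_div_iff₀ ha]
      linarith
  obtain ⟨f, hf, hlim⟩ := measurable_limit_of_tendsto_metrizable_ae
    (f := fun N x => ∑ i ∈ Finset.range N, d i x) (μ := μ) (L := atTop)
    (fun N => (Finset.measurable_fun_sum _ fun i _ => hd i).aemeasurable)
    (hsum.mono fun x hx => ⟨_, hx.hasSum.tendsto_sum_nat⟩)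
  refine ⟨f, hf, ?_, lintegral_mono_ae ?_⟩
  · filter_upwards [hsum, hlim] with x hx hl
    rw [← tendsto_nhds_unique hx.hasSum.tendsto_sum_nat hl]
    exact hx.hasSum
  · filter_upwards [hlim] with x hl
    have h1 : Tendsto (fun N => ENNReal.ofReal (R (∑ i ∈ Finset.range N, d i x))) atTop
        (𝓝 (ENNReal.ofReal (R (f x)))) :=
      ENNReal.tendsto_ofReal ((hR.continuous.tendsto _).comp hl)
    refine le_of_tendsto' h1 fun N => ?_
    refine (ENNReal.ofReal_le_ofReal (hR.sum_le _ N)).trans ?_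
    rw [ENNReal.ofReal_sum_of_nonneg fun i _ => hR.nonneg _]
    exact ENNReal.sum_le_tsum _

/-- Uniform boundedness: if `f * g` is integrable for all `g` of finite modular, then the integrals
are bounded uniformly over the unit modular ball. -/
theorem exists_lintegral_mul_le {f : Ω → ℝ}
    (hf : ∀ g : Ω → ℝ, Measurable g → modular R μ g < ⊤ → Integrable (fun x => f x * g x) μ) :
    ∃ C : ℝ, 0 ≤ C ∧ ∀ g : Ω → ℝ, Measurable g → modular R μ g ≤ 1 →
      ∫⁻ x, ENNReal.ofReal |f x * g x| ∂μ ≤ ENNReal.ofReal C := by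
  by_contra! hcon
  have hcon' : ∀ n : ℕ, ∃ g : Ω → ℝ, Measurable g ∧ modular R μ g ≤ 1 ∧
      ENNReal.ofReal (4 ^ (n + 1) * n) < ∫⁻ x, ENNReal.ofReal |f x * g x| ∂μ := fun n =>
    hcon (4 ^ (n + 1) * n) (by positivity)
  choose g hgm hg1 hg2 using hcon'
  -- Of the factor `4 ^ (n + 1)`, one `2 ^ (n + 1)` pays for the weight in the series lemma and the
  -- other makes the modulars summable.
  set d : ℕ → Ω → ℝ := fun n x => (1 / 4) ^ (n + 1) * |g n x| with hd
  have hdm : ∀ n, Measurable (d n) := fun n => (hgm n).abs.const_mul _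
  have hle : ∀ n, modular R μ (fun x => 2 ^ (n + 1) * d n x) ≤ ENNReal.ofReal ((1 / 2) ^ (n + 1)) := by
    intro n
    have e : (fun x => 2 ^ (n + 1) * d n x) = fun x => (1 / 2 : ℝ) ^ (n + 1) * |g n x| := by
      funext x
      simp only [hd]
      rw [← mul_assoc, ← mul_pow]
      norm_num
    rw [e]
    refine (hR.modular_mul_le (by positivity) (pow_le_one₀ (by norm_num) (by norm_num)) _).trans ?_
    refine mul_le_of_le_one_right' ?_
    refine (hR.modular_mono fun x => ?_).trans (hg1 n)
    rw [abs_abs]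
  have hsum : ∑' n, modular R μ (fun x => 2 ^ (n + 1) * d n x) ≠ ⊤ := by
    refine ne_top_of_le_ne_top ?_ (ENNReal.tsum_le_tsum hle)
    rw [← ENNReal.ofReal_tsum_of_nonneg (fun n => by positivity)
      ((summable_nat_add_iff 1).2 summable_geometric_two)]
    exact ENNReal.ofReal_ne_top
  obtain ⟨G, hGm, hGs, hG⟩ := hR.exists_hasSum_of_tsum_modular hdm hsum
  have hint := hf G hGm (hG.trans_lt hsum.lt_top)
  have hfin : ∫⁻ x, ENNReal.ofReal |f x * G x| ∂μ < ⊤ := by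
    have := hint.2
    simpa [HasFiniteIntegral, ← ofReal_norm, Real.norm_eq_abs] using this
  obtain ⟨n, hn⟩ := exists_nat_gt (∫⁻ x, ENNReal.ofReal |f x * G x| ∂μ).toReal
  have h1 : ∫⁻ x, ENNReal.ofReal |f x * g n x| ∂μ
      ≤ ENNReal.ofReal (4 ^ (n + 1)) * ∫⁻ x, ENNReal.ofReal |f x * G x| ∂μ := by
    rw [← lintegral_const_mul' _ _ ENNReal.ofReal_ne_top]
    refine lintegral_mono_ae ?_
    filter_upwards [hGs] with x hx
    rw [← ENNReal.ofReal_mul (by positivity)]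
    refine ENNReal.ofReal_le_ofReal ?_
    have h2 : d n x ≤ G x := le_hasSum hx n fun i _ => by positivity
    have h3 : |g n x| = 4 ^ (n + 1) * d n x := by
      simp only [hd]
      rw [← mul_assoc, ← mul_pow]
      norm_num
    rw [abs_mul, abs_mul, h3]
    calc |f x| * (4 ^ (n + 1) * d n x) ≤ |f x| * (4 ^ (n + 1) * |G x|) := by
          gcongr; exact h2.trans (le_abs_self _)
      _ = _ := by ring
  have h2 := (hg2 n).trans_le h1
  rw [ENNReal.ofReal_mul (by positivity)] at h2
  have h3 := lt_of_mul_lt_mul_left' h2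
  rw [← ENNReal.ofReal_toReal hfin.ne] at h3
  exact (ENNReal.ofReal_lt_ofReal_iff_of_nonneg (by positivity)).1 h3 |>.not_gt hn

end IsYoungFunction

/-! ### Semifinite measures. -/

namespace IsSemifinite

theorem exists_subset_pos_lt_top (hμ : IsSemifinite μ) {s : Set Ω} (hs : MeasurableSet s)
    (h : μ s ≠ 0) : ∃ t ⊆ s, MeasurableSet t ∧ 0 < μ t ∧ μ t < ⊤ := by
  by_cases htop : μ s = ⊤
  · exact hμ s hs htop
  · exact ⟨s, subset_rfl, hs, pos_iff_ne_zero.2 h, lt_top_iff_ne_top.2 htop⟩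

/-- Inside a finite-measure piece of `{F ≠ 0}`, some truncation `{F ≤ n}` still has positive
measure, and there the density is bounded. -/
theorem withDensity (hμ : IsSemifinite μ) {F : Ω → ENNReal} (hF : Measurable F)
    (hFtop : ∀ x, F x ≠ ⊤) : IsSemifinite (μ.withDensity F) := by
  intro s hs htop
  have hsF : MeasurableSet (s ∩ {x | F x ≠ 0}) :=
    hs.inter (hF (measurableSet_singleton 0).compl)
  have h1 : μ (s ∩ {x | F x ≠ 0}) ≠ 0 := by
    intro h0
    have : μ.withDensity F s = 0 := by
      rw [withDensity_apply_eq_zero hF, Set.inter_comm]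
      exact h0
    simp [this] at htop
  obtain ⟨t, hts, htm, ht0, httop⟩ := hμ.exists_subset_pos_lt_top hsF h1
  have hU : t ⊆ ⋃ n : ℕ, t ∩ {x | F x ≤ n} := fun x hx => by
    obtain ⟨n, hn⟩ := ENNReal.exists_nat_gt (hFtop x)
    exact Set.mem_iUnion.2 ⟨n, hx, hn.le⟩
  have h2 : ∃ n : ℕ, μ (t ∩ {x | F x ≤ n}) ≠ 0 := by
    by_contra! hn
    exact (measure_mono_null hU (measure_iUnion_null hn) ▸ ht0).false
  obtain ⟨n, hn⟩ := h2
  have hm : MeasurableSet (t ∩ {x | F x ≤ n}) := htm.inter (measurableSet_le hF measurable_const)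
  refine ⟨t ∩ {x | F x ≤ n}, Set.inter_subset_left.trans (hts.trans Set.inter_subset_left), hm,
    ?_, ?_⟩
  · rw [pos_iff_ne_zero, Ne, withDensity_apply_eq_zero hF]
    rwa [Set.inter_eq_right.2 fun x hx => (hts hx.1).2]
  · rw [withDensity_apply _ hm]
    calc ∫⁻ x in t ∩ {x | F x ≤ n}, F x ∂μ ≤ ∫⁻ _ in t ∩ {x | F x ≤ n}, (n : ENNReal) ∂μ :=
          setLIntegral_mono' hm fun x hx => hx.2
      _ = n * μ (t ∩ {x | F x ≤ n}) := setLIntegral_const _ _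
      _ < ⊤ := ENNReal.mul_lt_top (by simp)
          ((measure_mono Set.inter_subset_left).trans_lt httop)

/-- Exhaustion: if finite measures were bounded by `K`, the union of a maximising sequence would
attain their supremum. Its complement would have infinite measure, so a piece of positive finite
measure could be added. -/
theorem exists_lt_measure_lt_top (hμ : IsSemifinite μ) (h : μ Set.univ = ⊤) {K : ENNReal}
    (hK : K ≠ ⊤) : ∃ s, MeasurableSet s ∧ K < μ s ∧ μ s < ⊤ := by
  by_contra! hcon
  have hle : ∀ s, MeasurableSet s → μ s ≠ ⊤ → μ s ≤ K := fun s hs hst => by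
    by_contra! hlt
    exact hst (top_le_iff.1 (hcon s hs hlt))
  set V : Set ENNReal := {r | ∃ s, MeasurableSet s ∧ μ s ≠ ⊤ ∧ μ s = r} with hV
  have hVne : V.Nonempty := ⟨0, ∅, MeasurableSet.empty, by simp, by simp⟩
  obtain ⟨u, -, hu, huV⟩ := exists_seq_tendsto_sSup hVne (OrderTop.bddAbove V)
  choose S hSm hSt hSu using huV
  have hsup : sSup V ≤ K := sSup_le fun r ⟨s, hs, hst, hr⟩ => hr ▸ hle s hs hst
  have hUm : MeasurableSet (⋃ n, S n) := MeasurableSet.iUnion hSm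
  have hUle : μ (⋃ n, S n) ≤ sSup V := by
    rw [measure_iUnion_eq_iSup_accumulate]
    refine iSup_le fun n => le_sSup ⟨_, ?_, ?_, rfl⟩
    · exact MeasurableSet.biUnion (Set.to_countable _) fun i _ => hSm i
    · exact ((measure_biUnion_lt_top (Set.finite_Iic n) fun i _ => (hSt i).lt_top)).ne
  have hUge : sSup V ≤ μ (⋃ n, S n) :=
    le_of_tendsto' hu fun n => (hSu n).symm.le.trans (measure_mono (Set.subset_iUnion S n))
  have hUtop : μ (⋃ n, S n) ≠ ⊤ := ne_top_of_le_ne_top hK (hUle.trans hsup)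
  have hc : μ (⋃ n, S n)ᶜ = ⊤ := by
    rw [measure_compl hUm hUtop, h, ENNReal.top_sub hUtop]
  obtain ⟨t, htU, htm, ht0, httop⟩ := hμ _ hUm.compl hc
  have hdisj : μ ((⋃ n, S n) ∪ t) = μ (⋃ n, S n) + μ t :=
    measure_union (Set.disjoint_left.2 fun x hx hxt => htU hxt hx) htm
  have h3 : μ (⋃ n, S n) + μ t ≤ μ (⋃ n, S n) := by
    refine le_trans ?_ hUge
    refine le_sSup ⟨_, hUm.union htm, ?_, hdisj⟩
    rw [hdisj]
    exact ENNReal.add_ne_top.2 ⟨hUtop, httop.ne⟩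
  exact (ENNReal.lt_add_right hUtop ht0.ne').not_ge h3

end IsSemifinite

/-! ### Elements of `L^P` have finite modular. -/

theorem IsYoungFunction.integrable_comp_iff {R : ℝ → ℝ} (hR : IsYoungFunction R) {f : Ω → ℝ}
    (hf : Measurable f) : Integrable (fun x => R (f x)) μ ↔ modular R μ f < ⊤ := by
  rw [Integrable, hasFiniteIntegral_iff_ofReal (Eventually.of_forall fun x => hR.nonneg _)]
  exact and_iff_right (hR.measurable.comp hf).aestronglyMeasurable

namespace IsNFunction

variable {P : ℝ → ℝ} (hP : IsNFunction P)
include hP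

theorem integrable_mul {f g : Ω → ℝ} (hf : Measurable f) (hg : Measurable g)
    (hfm : modular P μ f < ⊤) (hgm : modular (convexConjugate P) μ g < ⊤) :
    Integrable (fun x => f x * g x) μ :=
  ((((hP.isYoungFunction.integrable_comp_iff hf).2 hfm)).add
    ((hP.isYoungFunction_conjugate.integrable_comp_iff hg).2 hgm)).mono'
    (hf.mul hg).aestronglyMeasurable (Eventually.of_forall fun _ => hP.young_inequality _ _)

/-- Let `I = ∫_S P(f) dμ` be finite but huge. Scaling `P'(f)` on `S` by `(2 / α) ^ (n + 1)`, with `α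
^ (n + 1)` just above `α I`, puts it in the modular unit ball of `Q`. Its product with `f` still
integrates to at least `2 ^ (n + 1) / α ^ 2`, which exceeds the uniform bound `C`. -/
theorem modular_lt_top_of_integrable_mul (hμ : IsSemifinite μ) (hdiff : Differentiable ℝ P)
    {α : ℝ} (hα : 4 ≤ α) (hd : ∀ u, P (2 * u) ≤ α * P u) {f : Ω → ℝ} (hf : Measurable f)
    (h : ∀ g : Ω → ℝ, Measurable g → modular (convexConjugate P) μ g < ⊤ →
      Integrable (fun x => f x * g x) μ) : modular P μ f < ⊤ := by
  have hα0 : 0 < α := by linarith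
  have hY := hP.isYoungFunction
  have hQ := hP.isYoungFunction_conjugate
  obtain ⟨C, hC0, hC⟩ := hQ.exists_lintegral_mul_le h
  by_contra htop
  rw [not_lt, top_le_iff] at htop
  have hFm := hY.measurable_ofReal_comp hf
  obtain ⟨m, hm⟩ := pow_unbounded_of_one_lt (C * α ^ 2) (one_lt_two (α := ℝ))
  obtain ⟨S, hS, hKS, hSt⟩ := (hμ.withDensity hFm fun _ => ENNReal.ofReal_ne_top)
    |>.exists_lt_measure_lt_top (by rwa [withDensity_apply _ MeasurableSet.univ, Measure.restrict_univ])
    -- `I > α ^ m` will force `m < n + 1`, hence `2 ^ (n + 1) > C * α ^ 2`.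
    (K := ENNReal.ofReal (α ^ m)) ENNReal.ofReal_ne_top
  rw [withDensity_apply _ hS] at hKS hSt
  set I : ℝ := (∫⁻ x in S, ENNReal.ofReal (P (f x)) ∂μ).toReal with hI
  have hIe : ∫⁻ x in S, ENNReal.ofReal (P (f x)) ∂μ = ENNReal.ofReal I :=
    (ENNReal.ofReal_toReal hSt.ne).symm
  rw [hIe, ENNReal.ofReal_lt_ofReal_iff_of_nonneg (by positivity)] at hKS
  have hI1 : 1 < I := (one_le_pow₀ (by linarith)).trans_lt hKS
  obtain ⟨n, hn1, hn2⟩ := exists_nat_pow_near (x := α * I) (y := α) (by nlinarith) (by linarith)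
  have hmn : m < n + 1 := by
    by_contra! hle
    have h1 : α ^ (n + 1) ≤ α ^ m := pow_le_pow_right₀ (by linarith) hle
    nlinarith
  set g : Ω → ℝ := S.indicator fun x => (2 / α) ^ (n + 1) * deriv P (f x) with hg
  have hgm : Measurable g :=
    (((measurable_deriv P).comp hf).const_mul _).indicator hS
  have hg1 : modular (convexConjugate P) μ g ≤ 1 := by
    calc modular (convexConjugate P) μ g
        = ∫⁻ x in S, ENNReal.ofReal (convexConjugate P ((2 / α) ^ (n + 1) * deriv P (f x))) ∂μ := by
          rw [modular, ← lintegral_indicator hS]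
          refine lintegral_congr fun x => ?_
          by_cases hx : x ∈ S <;> simp [hg, hx, hQ.map_zero]
      _ ≤ ∫⁻ x in S, ENNReal.ofReal ((1 / α) ^ (n + 1) * α) * ENNReal.ofReal (P (f x)) ∂μ := by
          refine lintegral_mono fun x => ?_
          rw [← ENNReal.ofReal_mul (by positivity)]
          refine ENNReal.ofReal_le_ofReal ?_
          refine (hP.conjugate_two_div_pow_mul_le hα0 hd _ _).trans ?_
          rw [mul_assoc]
          gcongr
          exact hP.conjugate_deriv_le hdiff hd _
      _ = ENNReal.ofReal ((1 / α) ^ (n + 1) * (α * I)) := by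
          rw [lintegral_const_mul' _ _ ENNReal.ofReal_ne_top, hIe,
            ← ENNReal.ofReal_mul (by positivity), mul_assoc]
      _ ≤ 1 := by
          rw [ENNReal.ofReal_le_one, one_div, inv_pow, inv_mul_le_iff₀ (by positivity), mul_one]
          exact hn2.le
  have hfg : ENNReal.ofReal ((2 / α) ^ (n + 1) * I) ≤ ∫⁻ x, ENNReal.ofReal |f x * g x| ∂μ := by
    calc ENNReal.ofReal ((2 / α) ^ (n + 1) * I)
        = ∫⁻ x in S, ENNReal.ofReal ((2 / α) ^ (n + 1) * P (f x)) ∂μ := by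
          rw [ENNReal.ofReal_mul (by positivity), ← hIe,
            ← lintegral_const_mul' _ _ ENNReal.ofReal_ne_top]
          exact lintegral_congr fun x => (ENNReal.ofReal_mul (by positivity)).symm
      _ ≤ ∫⁻ x in S, ENNReal.ofReal |f x * g x| ∂μ := by
          refine setLIntegral_mono' hS fun x hx => ENNReal.ofReal_le_ofReal ?_
          refine le_trans ?_ (le_abs_self _)
          simp only [hg, Set.indicator_of_mem hx]
          calc (2 / α) ^ (n + 1) * P (f x) ≤ (2 / α) ^ (n + 1) * (f x * deriv P (f x)) := by
                gcongr; exact hP.le_mul_deriv hdiff _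
            _ = _ := by ring
      _ ≤ _ := setLIntegral_le_lintegral _ _
  have h2 := (ENNReal.ofReal_le_ofReal_iff hC0).1 (hfg.trans (hC g hgm hg1))
  have h3 : (2 : ℝ) ^ (n + 1) ≤ C * α ^ 2 := by
    calc (2 : ℝ) ^ (n + 1) = (2 / α) ^ (n + 1) * (α ^ n * α) := by
          rw [div_pow, ← pow_succ, div_mul_cancel₀ _ (by positivity)]
      _ ≤ (2 / α) ^ (n + 1) * (α * I * α) := by gcongr
      _ = (2 / α) ^ (n + 1) * I * α ^ 2 := by ring
      _ ≤ C * α ^ 2 := by gcongr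
  have h4 : (2 : ℝ) ^ m ≤ 2 ^ (n + 1) := pow_le_pow_right₀ one_le_two hmn.le
  linarith

end IsNFunction

/-! ### Convexity and doubling of the modular. -/

namespace IsYoungFunction

variable {R : ℝ → ℝ} (hR : IsYoungFunction R)
include hR

theorem modular_convexComb_le {a b : ℝ} (ha : 0 ≤ a) (hb : 0 ≤ b) (hab : a + b = 1)
    {f : Ω → ℝ} (hf : Measurable f) (g : Ω → ℝ) :
    modular R μ (fun x => a * f x + b * g x)
      ≤ ENNReal.ofReal a * modular R μ f + ENNReal.ofReal b * modular R μ g := by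
  rw [modular, modular, modular, ← lintegral_const_mul' _ _ ENNReal.ofReal_ne_top,
    ← lintegral_const_mul' _ _ ENNReal.ofReal_ne_top,
    ← lintegral_add_left ((hR.measurable_ofReal_comp hf).const_mul _)]
  refine lintegral_mono fun x => ?_
  rw [← ENNReal.ofReal_mul ha, ← ENNReal.ofReal_mul hb,
    ← ENNReal.ofReal_add (mul_nonneg ha (hR.nonneg _)) (mul_nonneg hb (hR.nonneg _))]
  exact ENNReal.ofReal_le_ofReal (hR.map_convexComb_le ha hb hab _ _)

theorem modular_neg (f : Ω → ℝ) : modular R μ (fun x => -f x) = modular R μ f := by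
  simp only [modular, hR.even _]

variable {α : ℝ} (hα : 4 ≤ α) (hd : ∀ u, R (2 * u) ≤ α * R u)
include hα hd

omit hR in
theorem modular_two_pow_mul_le (n : ℕ) (f : Ω → ℝ) :
    modular R μ (fun x => 2 ^ n * f x) ≤ ENNReal.ofReal (α ^ n) * modular R μ f := by
  have h : ∀ (n : ℕ) (u : ℝ), R (2 ^ n * u) ≤ α ^ n * R u := by
    intro n
    induction n with
    | zero => simp
    | succ n ih =>
      intro u
      calc R (2 ^ (n + 1) * u) = R (2 * (2 ^ n * u)) := by ring_nf
        _ ≤ α * R (2 ^ n * u) := hd _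
        _ ≤ α * (α ^ n * R u) := by gcongr; exact ih u
        _ = _ := by ring
  rw [modular, modular, ← lintegral_const_mul' _ _ ENNReal.ofReal_ne_top]
  refine lintegral_mono fun x => ?_
  rw [← ENNReal.ofReal_mul (by positivity)]
  exact ENNReal.ofReal_le_ofReal (h n _)

theorem modular_add_le {f : Ω → ℝ} (hf : Measurable f) (g : Ω → ℝ) :
    modular R μ (fun x => f x + g x)
      ≤ ENNReal.ofReal α * (modular R μ f + modular R μ g) := by
  have h1 := modular_two_pow_mul_le (μ := μ) hα hd 1 (fun x => 1 / 2 * f x + 1 / 2 * g x)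
  have e : (fun x => 2 ^ 1 * (1 / 2 * f x + 1 / 2 * g x)) = fun x => f x + g x := by
    funext x; ring
  rw [e, pow_one] at h1
  refine h1.trans ?_
  gcongr
  refine (hR.modular_convexComb_le (by norm_num) (by norm_num) (by norm_num) hf g).trans ?_
  have : ENNReal.ofReal (1 / 2) ≤ 1 := by rw [ENNReal.ofReal_le_one]; norm_num
  gcongr <;> exact mul_le_of_le_one_left' this

theorem modular_add_lt_top {f g : Ω → ℝ} (hf : Measurable f) (hfm : modular R μ f < ⊤)
    (hgm : modular R μ g < ⊤) : modular R μ (fun x => f x + g x) < ⊤ :=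
  (hR.modular_add_le hα hd hf g).trans_lt
    (ENNReal.mul_lt_top ENNReal.ofReal_lt_top (ENNReal.add_lt_top.2 ⟨hfm, hgm⟩))

theorem modular_mul_lt_top (c : ℝ) {f : Ω → ℝ} (hfm : modular R μ f < ⊤) :
    modular R μ (fun x => c * f x) < ⊤ := by
  obtain ⟨n, hn⟩ := pow_unbounded_of_one_lt |c| (one_lt_two (α := ℝ))
  refine (hR.modular_mono (g := fun x => 2 ^ n * f x) fun x => ?_).trans_lt
    ((modular_two_pow_mul_le hα hd n f).trans_lt
      (ENNReal.mul_lt_top ENNReal.ofReal_lt_top hfm))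
  rw [abs_mul, abs_mul, abs_of_pos (by positivity : (0 : ℝ) < 2 ^ n)]
  gcongr

theorem ae_eq_zero_of_modular_eq_zero {f : Ω → ℝ} (hf : Measurable f)
    (h : modular R μ f = 0) : ∀ᵐ x ∂μ, f x = 0 := by
  have h1 : ∀ n : ℕ, ∀ᵐ x ∂μ, R (2 ^ n * f x) = 0 := fun n => by
    have h2 : modular R μ (fun x => 2 ^ n * f x) = 0 := by
      have := modular_two_pow_mul_le (μ := μ) hα hd n f
      rwa [h, mul_zero, nonpos_iff_eq_zero] at this
    rw [modular, lintegral_eq_zero_iff (hR.measurable_ofReal_comp (hf.const_mul _))] at h2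
    filter_upwards [h2] with x hx
    exact le_antisymm (ENNReal.ofReal_eq_zero.1 hx) (hR.nonneg _)
  filter_upwards [ae_all_iff.2 h1] with x hx
  exact hR.eq_zero_of_forall_mul hx

end IsYoungFunction

/-! ### The Luxemburg norm. -/

namespace LuxemburgSpace

variable {P : ℝ → ℝ}

theorem measurable (f : LuxemburgSpace P μ) : Measurable f := AEEqFun.measurable _

theorem coe_zero : ((0 : LuxemburgSpace P μ) : Ω → ℝ) =ᵐ[μ] 0 := AEEqFun.coeFn_zero

theorem coe_add (f g : LuxemburgSpace P μ) :
    ((f + g : LuxemburgSpace P μ) : Ω → ℝ) =ᵐ[μ] fun x => f x + g x := AEEqFun.coeFn_add _ _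

theorem coe_smul (c : ℝ) (f : LuxemburgSpace P μ) :
    ((c • f : LuxemburgSpace P μ) : Ω → ℝ) =ᵐ[μ] fun x => c * f x := AEEqFun.coeFn_smul _ _

theorem ext {f g : LuxemburgSpace P μ} (h : (f : Ω → ℝ) =ᵐ[μ] g) : f = g :=
  Subtype.ext (AEEqFun.ext h)

theorem exists_coe_eq (hP : IsNFunction P) {f : Ω → ℝ} (hf : Measurable f)
    (hfm : modular P μ f < ⊤) : ∃ F : LuxemburgSpace P μ, (F : Ω → ℝ) =ᵐ[μ] f := by
  have hc := AEEqFun.coeFn_mk f hf.aestronglyMeasurable (μ := μ)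
  refine ⟨⟨AEEqFun.mk f hf.aestronglyMeasurable, fun g hg hgm => ?_⟩, hc⟩
  exact (hP.integrable_mul hf hg hfm hgm).congr (hc.mono fun x hx => by simp only [hx])

variable (hP : IsNFunction P)

theorem norm_nonneg (f : LuxemburgSpace P μ) : 0 ≤ ‖f‖ :=
  Real.sInf_nonneg fun _ hk => hk.1.le

theorem norm_le_of_modular_le {f : LuxemburgSpace P μ} {k : ℝ} (hk : 0 < k)
    (h : modular P μ (fun x => k⁻¹ * f x) ≤ 1) : ‖f‖ ≤ k :=
  csInf_le ⟨0, fun _ hk => hk.1.le⟩ ⟨hk, h⟩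

variable (hfin : ∀ f : LuxemburgSpace P μ, modular P μ f < ⊤)
include hP hfin

theorem modular_le_one_of_norm_lt {f : LuxemburgSpace P μ} {k : ℝ} (h : ‖f‖ < k) :
    modular P μ (fun x => k⁻¹ * f x) ≤ 1 := by
  have hne : {k : ℝ | 0 < k ∧ modular P μ (fun x => k⁻¹ * f x) ≤ 1}.Nonempty := by
    -- Finite modular makes the set of admissible `k` nonempty, so the infimum is not a default
    -- value: dividing by `k ≥ 1` divides the modular by at least `k`.
    have h1 : 0 < max 1 (modular P μ f).toReal := lt_max_of_lt_left one_pos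
    refine ⟨max 1 (modular P μ f).toReal, h1, ?_⟩
    refine (hP.isYoungFunction.modular_mul_le (by positivity)
      (inv_le_one_of_one_le₀ (le_max_left _ _)) _).trans ?_
    rw [← ENNReal.ofReal_toReal (hfin f).ne, ← ENNReal.ofReal_mul (by positivity),
      ENNReal.ofReal_le_one, ENNReal.toReal_ofReal ENNReal.toReal_nonneg,
      inv_mul_le_iff₀ h1, mul_one]
    exact le_max_right _ _
  obtain ⟨k', ⟨hk'0, hk'⟩, hlt⟩ := exists_lt_of_csInf_lt hne h
  refine (hP.isYoungFunction.modular_mono fun x => ?_).trans hk'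
  rw [abs_mul, abs_mul, abs_of_pos (inv_pos.2 hk'0), abs_of_pos (inv_pos.2 (hk'0.trans hlt))]
  gcongr

theorem normCore {α : ℝ} (hα : 4 ≤ α) (hd : ∀ u, P (2 * u) ≤ α * P u) :
    NormedSpace.Core ℝ (LuxemburgSpace P μ) := by
  have hY := hP.isYoungFunction
  have hle : ∀ c : ℝ, c ≠ 0 → ∀ f : LuxemburgSpace P μ, ‖c • f‖ ≤ |c| * ‖f‖ := by
    intro c hc f
    have hc' := abs_pos.2 hc
    rw [← div_le_iff₀' hc']
    refine le_of_forall_gt_imp_ge_of_dense fun k hk => ?_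
    have hk0 : 0 < k := (norm_nonneg f).trans_lt hk
    rw [div_le_iff₀' hc']
    refine norm_le_of_modular_le (by positivity) ?_
    refine le_trans (le_of_eq ?_) (modular_le_one_of_norm_lt hP hfin hk)
    rw [modular_congr_ae (g := fun x => (|c| * k)⁻¹ * (c * f x))
      ((coe_smul c f).mono fun x hx => by simp only [hx])]
    rcases abs_choice c with h | h <;> rw [h]
    · congr 1; funext x; field_simp
    · rw [← hY.modular_neg]; congr 1; funext x; field_simp
  have hzero : ‖(0 : LuxemburgSpace P μ)‖ = 0 := by
    refine le_antisymm (le_of_forall_gt_imp_ge_of_dense fun k hk => ?_) (norm_nonneg _)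
    refine norm_le_of_modular_le hk ?_
    rw [modular_congr_ae (g := fun _ => (0 : ℝ))
      ((coe_zero (P := P)).mono fun x hx => by simp only [hx, Pi.zero_apply, mul_zero])]
    simp [modular, hY.map_zero]
  refine { norm_nonneg := norm_nonneg, norm_smul := fun c f => ?_, norm_triangle := fun f g => ?_,
           norm_eq_zero_iff := fun f => ⟨fun h => ?_, fun h => h ▸ hzero⟩ }
  · rcases eq_or_ne c 0 with rfl | hc
    · simp [hzero]
    · refine le_antisymm (hle c hc f) ?_
      have h1 := hle c⁻¹ (inv_ne_zero hc) (c • f)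
      rw [inv_smul_smul₀ hc, abs_inv] at h1
      rw [Real.norm_eq_abs]
      rwa [← div_eq_inv_mul, le_div_iff₀' (abs_pos.2 hc)] at h1
  · refine le_of_forall_pos_le_add fun ε hε => ?_
    have hf := modular_le_one_of_norm_lt hP hfin (lt_add_of_pos_right ‖f‖ (half_pos hε))
    have hg := modular_le_one_of_norm_lt hP hfin (lt_add_of_pos_right ‖g‖ (half_pos hε))
    have hk : 0 < ‖f‖ + ε / 2 := by linarith [norm_nonneg f]
    have hl : 0 < ‖g‖ + ε / 2 := by linarith [norm_nonneg g]
    set k := ‖f‖ + ε / 2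
    set l := ‖g‖ + ε / 2
    have e : ‖f‖ + ‖g‖ + ε = k + l := by simp only [k, l]; ring
    rw [e]
    refine norm_le_of_modular_le (by positivity) ?_
    -- The triangle inequality: `(f + g) / (k + l)` is a convex combination of `f / k` and `g / l`.
    rw [modular_congr_ae (g := fun x => k / (k + l) * (k⁻¹ * f x) + l / (k + l) * (l⁻¹ * g x))
      ((coe_add f g).mono fun x hx => by simp only [hx]; field_simp)]
    refine (hY.modular_convexComb_le (by positivity) (by positivity) (by field_simp)
      (f.measurable.const_mul _) _).trans ?_
    calc _ ≤ ENNReal.ofReal (k / (k + l)) * 1 + ENNReal.ofReal (l / (k + l)) * 1 := by gcongr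
      _ = 1 := by
        rw [mul_one, mul_one, ← ENNReal.ofReal_add (by positivity) (by positivity), ← add_div,
          div_self (by positivity), ENNReal.ofReal_one]
  · refine ext ?_
    have h0 : modular P μ f = 0 := by
      refine le_antisymm (ENNReal.le_of_forall_pos_le_add fun ε hε _ => ?_) zero_le
      -- Write `f = t * (t⁻¹ * f)` with `t = min ε 1`; the cap at `1` permits the convexity bound
      -- `modular f ≤ t`.
      have hm : 0 < min (ε : ℝ) 1 := lt_min (by exact_mod_cast hε) one_pos
      have h1 := modular_le_one_of_norm_lt hP hfin (f := f) (h.trans_lt hm)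
      have h2 := hY.modular_mul_le (μ := μ) hm.le (min_le_right _ _)
        (fun x => (min (ε : ℝ) 1)⁻¹ * f x)
      simp only [mul_inv_cancel_left₀ hm.ne'] at h2
      refine h2.trans ((mul_le_of_le_one_right' h1).trans ?_)
      rw [zero_add]
      exact (ENNReal.ofReal_le_ofReal (min_le_left _ _)).trans_eq (ENNReal.ofReal_coe_nnreal)
    filter_upwards [hY.ae_eq_zero_of_modular_eq_zero hα hd f.measurable h0,
      coe_zero (P := P) (μ := μ)] with x hx h0
    rw [hx, h0]; rfl

end LuxemburgSpace

/-! ### The Orlicz norm. -/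

namespace ConjugateOrliczSpace

variable {P : ℝ → ℝ}

theorem measurable (g : ConjugateOrliczSpace P μ) : Measurable g := AEEqFun.measurable _

theorem coe_zero : ((0 : ConjugateOrliczSpace P μ) : Ω → ℝ) =ᵐ[μ] 0 := AEEqFun.coeFn_zero

theorem coe_add (f g : ConjugateOrliczSpace P μ) :
    ((f + g : ConjugateOrliczSpace P μ) : Ω → ℝ) =ᵐ[μ] fun x => f x + g x :=
  AEEqFun.coeFn_add _ _

theorem coe_smul (c : ℝ) (f : ConjugateOrliczSpace P μ) :
    ((c • f : ConjugateOrliczSpace P μ) : Ω → ℝ) =ᵐ[μ] fun x => c * f x :=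
  AEEqFun.coeFn_smul _ _

theorem ext {f g : ConjugateOrliczSpace P μ} (h : (f : Ω → ℝ) =ᵐ[μ] g) : f = g :=
  Subtype.ext (AEEqFun.ext h)

theorem integrable_mul (g : ConjugateOrliczSpace P μ) {f : Ω → ℝ} (hf : Measurable f)
    (hfm : modular P μ f < ⊤) : Integrable (fun x => f x * g x) μ :=
  (g.2 f hf hfm).congr (Eventually.of_forall fun _ => mul_comm _ _)

theorem exists_coe_eq {g : Ω → ℝ} (hg : Measurable g)
    (h : ∀ f : Ω → ℝ, Measurable f → modular P μ f < ⊤ → Integrable (fun x => f x * g x) μ) :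
    ∃ G : ConjugateOrliczSpace P μ, (G : Ω → ℝ) =ᵐ[μ] g := by
  have hc := AEEqFun.coeFn_mk g hg.aestronglyMeasurable (μ := μ)
  refine ⟨⟨AEEqFun.mk g hg.aestronglyMeasurable, fun f hf hfm => ?_⟩, hc⟩
  exact (h f hf hfm).congr (hc.mono fun x hx => by simp only [hx, mul_comm])

variable (hP : IsNFunction P)

include hP

/-- Uniform boundedness is what makes the defining set bounded above, so that the real `sSup` is a
true supremum. -/
theorem integral_mul_le_norm (g : ConjugateOrliczSpace P μ) {f : Ω → ℝ} (hf : Measurable f)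
    (hfm : modular P μ f ≤ 1) : ∫ x, f x * g x ∂μ ≤ ‖g‖ := by
  refine le_csSup ?_ ⟨f, hf, hfm, rfl⟩
  obtain ⟨C, hC0, hC⟩ := hP.isYoungFunction.exists_lintegral_mul_le g.2
  refine ⟨C, ?_⟩
  rintro _ ⟨f, hf, hfm, rfl⟩
  refine (le_abs_self _).trans ?_
  have h1 := hC f hf hfm
  have h2 := norm_integral_le_lintegral_norm (μ := μ) fun x => f x * g x
  refine h2.trans (ENNReal.toReal_le_of_le_ofReal hC0 ?_)
  refine le_trans (le_of_eq (lintegral_congr fun x => ?_)) h1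
  rw [Real.norm_eq_abs, mul_comm]

theorem norm_le {g : ConjugateOrliczSpace P μ} {M : ℝ}
    (h : ∀ f : Ω → ℝ, Measurable f → modular P μ f ≤ 1 → ∫ x, f x * g x ∂μ ≤ M) : ‖g‖ ≤ M := by
  refine csSup_le ⟨0, fun _ => 0, measurable_const, ?_, by simp⟩ ?_
  · simp [modular, hP.isYoungFunction.map_zero]
  · rintro _ ⟨f, hf, hfm, rfl⟩
    exact h f hf hfm

theorem norm_nonneg (g : ConjugateOrliczSpace P μ) : 0 ≤ ‖g‖ := by
  simpa using integral_mul_le_norm hP g (f := fun _ => 0) measurable_const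
    (by simp [modular, hP.isYoungFunction.map_zero])

/-- Semifiniteness gives a set `A` of positive finite measure inside `{g ≠ 0}`; the test function is
a small multiple of the sign of `g` on `A`. -/
theorem ae_eq_zero_of_norm_eq_zero (hμ : IsSemifinite μ) {g : ConjugateOrliczSpace P μ}
    (h : ‖g‖ = 0) : ∀ᵐ x ∂μ, g x = 0 := by
  have hY := hP.isYoungFunction
  by_contra hne
  obtain ⟨A, hA0, hAm, hApos, hAtop⟩ := hμ.exists_subset_pos_lt_top
    (s := {x | g x ≠ 0}) (g.measurable (measurableSet_singleton 0).compl) hne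
  -- Ensures `c * P 1 * μ(A) ≤ 1`; the summand `1` also gives `c ≤ 1`, needed for `P(c) ≤ c * P 1`.
  set c : ℝ := (1 + P 1 * μ.real A)⁻¹ with hc
  have hP1 := hY.nonneg 1
  have hden : 1 ≤ 1 + P 1 * μ.real A := by
    have : 0 ≤ P 1 * μ.real A := by positivity
    linarith
  have hc0 : 0 < c := by positivity
  have hc1 : c ≤ 1 := inv_le_one_of_one_le₀ hden
  have hsign : Measurable fun x => (SignType.sign (g x) : ℝ) := by
    have : (fun x => (SignType.sign (g x) : ℝ))
        = fun x => if 0 < g x then (1 : ℝ) else if g x < 0 then -1 else 0 := by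
      funext x
      rw [sign_apply]
      split_ifs <;> simp
    rw [this]
    exact Measurable.ite (measurableSet_lt measurable_const g.measurable) measurable_const
      (Measurable.ite (measurableSet_lt g.measurable measurable_const) measurable_const
        measurable_const)
  set f : Ω → ℝ := A.indicator fun x => c * (SignType.sign (g x) : ℝ) with hf
  have hfm : Measurable f := (hsign.const_mul c).indicator hAm
  have hfg : ∀ x, f x * g x = A.indicator (fun x => c * |g x|) x := fun x => by
    by_cases hx : x ∈ A
    · simp only [hf, Set.indicator_of_mem hx]
      rw [mul_assoc, sign_mul_self]
    · simp [hf, hx]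
  have hf1 : modular P μ f ≤ 1 := by
    calc modular P μ f ≤ ∫⁻ x, A.indicator (fun _ => ENNReal.ofReal (c * P 1)) x ∂μ := by
          refine lintegral_mono fun x => ?_
          by_cases hx : x ∈ A
          · simp only [hf, Set.indicator_of_mem hx]
            refine ENNReal.ofReal_le_ofReal (le_trans ?_ (hY.map_mul_le hc0.le hc1 1))
            refine hY.map_le_of_abs_le ?_
            rw [abs_mul, abs_mul]
            refine mul_le_mul_of_nonneg_left ?_ (abs_nonneg c)
            rw [sign_apply]
            split_ifs <;> simp
          · simp [hf, hx, hY.map_zero]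
      _ = ENNReal.ofReal (c * (P 1 * μ.real A)) := by
          rw [lintegral_indicator_const hAm, ← ofReal_measureReal hAtop.ne,
            ← ENNReal.ofReal_mul (by positivity), mul_assoc]
      _ ≤ 1 := by
          rw [ENNReal.ofReal_le_one, hc, inv_mul_le_iff₀ (by positivity)]
          linarith
  have hle := integral_mul_le_norm hP g hfm hf1
  have hint := integrable_mul g hfm (hf1.trans_lt ENNReal.one_lt_top)
  have hnn : 0 ≤ fun x => f x * g x := fun x => by
    simp only [hfg, Pi.zero_apply]
    exact Set.indicator_nonneg (fun _ _ => by positivity) _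
  have hz := (integral_eq_zero_iff_of_nonneg hnn hint).1
    (le_antisymm (hle.trans_eq h) (integral_nonneg hnn))
  have hnull : μ A = 0 := by
    refine measure_mono_null (fun x hx => ?_) hz
    simp only [Set.mem_compl_iff, Set.mem_ofPred_eq, hfg, Set.indicator_of_mem hx, Pi.zero_apply]
    exact (mul_pos hc0 (abs_pos.2 (hA0 hx))).ne'
  exact hApos.ne' hnull

theorem normCore (hμ : IsSemifinite μ) : NormedSpace.Core ℝ (ConjugateOrliczSpace P μ) := by
  have hY := hP.isYoungFunction
  have hle : ∀ (c : ℝ) (g : ConjugateOrliczSpace P μ), ‖c • g‖ ≤ |c| * ‖g‖ := by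
    intro c g
    refine norm_le hP fun f hf hfm => ?_
    have e : ∫ x, f x * (c • g) x ∂μ = c * ∫ x, f x * g x ∂μ := by
      rw [← integral_const_mul]
      refine integral_congr_ae ((coe_smul c g).mono fun x hx => ?_)
      simp only [hx]
      ring
    rw [e]
    rcases abs_choice c with h | h <;> rw [h]
    · have hc : 0 ≤ c := h ▸ abs_nonneg c
      exact mul_le_mul_of_nonneg_left (integral_mul_le_norm hP g hf hfm) hc
    · have hc : 0 ≤ -c := h ▸ abs_nonneg c
      have h1 := mul_le_mul_of_nonneg_left (integral_mul_le_norm hP g hf.neg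
        ((hY.modular_neg f).trans_le hfm)) hc
      have e2 : ∫ x, (-f) x * g x ∂μ = - ∫ x, f x * g x ∂μ := by
        rw [← integral_neg]
        exact integral_congr_ae (Eventually.of_forall fun x => by simp)
      rw [e2] at h1
      linarith
  refine { norm_nonneg := norm_nonneg hP, norm_smul := fun c g => ?_,
           norm_triangle := fun f g => ?_,
           norm_eq_zero_iff := fun g => ⟨fun h => ?_, fun h => ?_⟩ }
  · rcases eq_or_ne c 0 with rfl | hc
    · refine le_antisymm (hle 0 g) ?_
      simpa using norm_nonneg hP ((0 : ℝ) • g)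
    · refine le_antisymm (hle c g) ?_
      have h1 := hle c⁻¹ (c • g)
      rw [inv_smul_smul₀ hc, abs_inv] at h1
      rw [Real.norm_eq_abs]
      rwa [← div_eq_inv_mul, le_div_iff₀' (abs_pos.2 hc)] at h1
  · refine norm_le hP fun u hu hum => ?_
    have e : ∫ x, u x * (f + g) x ∂μ = ∫ x, u x * f x ∂μ + ∫ x, u x * g x ∂μ := by
      have hum' := hum.trans_lt ENNReal.one_lt_top
      rw [← integral_add (integrable_mul f hu hum') (integrable_mul g hu hum')]
      refine integral_congr_ae ((coe_add f g).mono fun x hx => ?_)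
      simp only [hx]
      ring
    rw [e]
    exact add_le_add (integral_mul_le_norm hP f hu hum) (integral_mul_le_norm hP g hu hum)
  · refine ext ?_
    filter_upwards [ae_eq_zero_of_norm_eq_zero hP hμ h, coe_zero (P := P) (μ := μ)] with x hx h0
    rw [hx, h0]
    rfl
  · refine le_antisymm ?_ (norm_nonneg hP g)
    have := hle 0 g
    rw [zero_smul, abs_zero, zero_mul] at this
    rwa [h]

end ConjugateOrliczSpace

/-! ### Fatou's lemma and completeness for the modular. -/

namespace IsYoungFunction

variable {R : ℝ → ℝ} (hR : IsYoungFunction R)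
include hR

theorem modular_eq_ofReal_integral {f : Ω → ℝ} (hf : Measurable f) (hfm : modular R μ f < ⊤) :
    modular R μ f = ENNReal.ofReal (∫ x, R (f x) ∂μ) :=
  (ofReal_integral_eq_lintegral_ofReal ((hR.integrable_comp_iff hf).2 hfm)
    (Eventually.of_forall fun _ => hR.nonneg _)).symm

theorem modular_le_liminf {u : ℕ → Ω → ℝ} (hu : ∀ n, Measurable (u n)) {f : Ω → ℝ}
    (h : ∀ᵐ x ∂μ, Tendsto (fun n => u n x) atTop (𝓝 (f x))) :
    modular R μ f ≤ liminf (fun n => modular R μ (u n)) atTop := by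
  refine le_trans (lintegral_mono_ae ?_)
    (lintegral_liminf_le fun n => hR.measurable_ofReal_comp (hu n))
  filter_upwards [h] with x hx
  exact (ENNReal.tendsto_ofReal ((hR.continuous.tendsto _).comp hx)).liminf_eq.ge

/-- Completeness with respect to modular convergence, for a doubling Young function. -/
theorem exists_tendsto_of_modular_cauchy {α : ℝ} (hα : 4 ≤ α) (hd : ∀ u, R (2 * u) ≤ α * R u)
    {u : ℕ → Ω → ℝ} (hu : ∀ n, Measurable (u n))
    (hC : ∀ ε : ENNReal, 0 < ε → ∃ N, ∀ n ≥ N, ∀ m ≥ N,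
      modular R μ (fun x => u n x - u m x) ≤ ε) :
    ∃ f : Ω → ℝ, Measurable f ∧
      (∃ ns : ℕ → ℕ, StrictMono ns ∧
        ∀ᵐ x ∂μ, Tendsto (fun k => u (ns k) x) atTop (𝓝 (f x))) ∧
      Tendsto (fun n => modular R μ (fun x => f x - u n x)) atTop (𝓝 0) := by
  have hα0 : 0 < α := by linarith
  -- Multiplying by `2 ^ (k + 1)` costs a factor `α ^ (k + 1)` in the modular; the rate `(1 / (2 *
  -- α)) ^ (k + 1)` leaves `(1 / 2) ^ (k + 1)`.
  obtain ⟨ns, hns, hle⟩ := extraction_forall_of_eventually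
    (P := fun k j => ∀ m ≥ j, modular R μ (fun x => u m x - u j x)
      ≤ ENNReal.ofReal ((1 / (2 * α)) ^ (k + 1))) fun k => by
    obtain ⟨N, hN⟩ := hC (ENNReal.ofReal ((1 / (2 * α)) ^ (k + 1)))
      (ENNReal.ofReal_pos.2 (by positivity))
    exact eventually_atTop.2 ⟨N, fun j hj m hm => hN m (hj.trans hm) j hj⟩
  set d : ℕ → Ω → ℝ := fun k x => u (ns (k + 1)) x - u (ns k) x with hdef
  have hdm : ∀ k, Measurable (d k) := fun k => (hu _).sub (hu _)
  have hsum : ∑' k, modular R μ (fun x => 2 ^ (k + 1) * d k x) ≠ ⊤ := by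
    refine ne_top_of_le_ne_top (b := ∑' k : ℕ, ENNReal.ofReal ((1 / 2) ^ (k + 1))) ?_
      (ENNReal.tsum_le_tsum fun k => ?_)
    · rw [← ENNReal.ofReal_tsum_of_nonneg (fun n => by positivity)
        ((summable_nat_add_iff 1).2 summable_geometric_two)]
      exact ENNReal.ofReal_ne_top
    · refine (modular_two_pow_mul_le hα hd _ _).trans ?_
      refine (mul_le_mul_right (hle k _ (hns.monotone k.le_succ)) _).trans ?_
      rw [← ENNReal.ofReal_mul (by positivity), ← mul_pow]
      have : α * (1 / (2 * α)) = 1 / 2 := by field_simp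
      rw [this]
  obtain ⟨f, hf, hfs, -⟩ := hR.exists_hasSum_of_tsum_modular hdm hsum
  have hlim : ∀ᵐ x ∂μ, Tendsto (fun k => u (ns k) x) atTop (𝓝 (f x + u (ns 0) x)) := by
    filter_upwards [hfs] with x hx
    have h1 := hx.tendsto_sum_nat.add_const (u (ns 0) x)
    refine h1.congr fun N => ?_
    simp only [hdef]
    rw [Finset.sum_range_sub (fun k => u (ns k) x)]
    ring
  refine ⟨fun x => f x + u (ns 0) x, hf.add (hu _), ⟨ns, hns, hlim⟩, ?_⟩
  rw [ENNReal.tendsto_atTop_zero]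
  intro ε hε
  obtain ⟨N, hN⟩ := hC ε hε
  refine ⟨N, fun n hn => ?_⟩
  -- Fatou along the subsequence with `n` fixed upgrades subsequential convergence to that of the
  -- whole sequence.
  refine (hR.modular_le_liminf (u := fun k x => u (ns k) x - u n x)
    (fun k => (hu _).sub (hu _)) (hlim.mono fun x hx => hx.sub_const _)).trans ?_
  refine liminf_le_of_frequently_le' (Eventually.frequently ?_)
  filter_upwards [eventually_ge_atTop N] with k hk
  exact hN _ (hk.trans (hns.le_apply)) _ hn

end IsYoungFunction

/-! ### Differentiating the modular. -/

namespace IsNFunction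

variable {P : ℝ → ℝ} (hP : IsNFunction P) (hdiff : Differentiable ℝ P)
include hP hdiff

/-- The tangent at `w`, evaluated at `w + h` and `w - h`, controls both signs. This gives the
dominating function for differentiation under the integral. -/
theorem abs_deriv_mul_le (w h : ℝ) : |deriv P w * h| ≤ P (w + h) + P (w - h) := by
  have h1 := hP.add_deriv_mul_le hdiff w (w + h)
  have h2 := hP.add_deriv_mul_le hdiff w (w - h)
  have h3 := hP.isYoungFunction.nonneg w
  have h4 := hP.isYoungFunction.nonneg (w + h)
  have h5 := hP.isYoungFunction.nonneg (w - h)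
  rw [abs_le]
  constructor <;> linarith

/-- The Gateaux derivative of the modular. -/
theorem hasDerivAt_integral_comp {α : ℝ} (hα : 4 ≤ α) (hd : ∀ u, P (2 * u) ≤ α * P u)
    {f h : Ω → ℝ} (hf : Measurable f) (hh : Measurable h) (hfm : modular P μ f < ⊤)
    (hhm : modular P μ h < ⊤) :
    Integrable (fun x => deriv P (f x) * h x) μ ∧
      HasDerivAt (fun t : ℝ => ∫ x, P (f x + t * h x) ∂μ) (∫ x, deriv P (f x) * h x ∂μ) 0 := by
  have hY := hP.isYoungFunction
  -- For `|t| ≤ 1` both `f + t h + h` and `f + t h - h` are at most `|f| + 2|h|` in absolute value;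
  -- doubling keeps its modular finite.
  have hb : modular P μ (fun x => |f x| + 2 * |h x|) < ⊤ :=
    hY.modular_add_lt_top hα hd hf.abs ((hY.modular_mono fun x => by simp).trans_lt hfm)
      (hY.modular_mul_lt_top hα hd 2 ((hY.modular_mono fun x => by simp).trans_lt hhm))
  have hbi := (hY.integrable_comp_iff (hf.abs.add (hh.abs.const_mul 2))).2 hb
  have key := hasDerivAt_integral_of_dominated_loc_of_deriv_le (𝕜 := ℝ) (μ := μ)
    (F := fun t x => P (f x + t * h x)) (x₀ := (0 : ℝ)) (s := Set.Icc (-1) 1)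
    (F' := fun t x => deriv P (f x + t * h x) * h x)
    (bound := fun x => 2 * P (|f x| + 2 * |h x|))
    (Icc_mem_nhds (by norm_num) (by norm_num))
    (Eventually.of_forall fun t =>
      (hY.measurable.comp (hf.add (hh.const_mul t))).aestronglyMeasurable)
    (by simpa using (hY.integrable_comp_iff hf).2 hfm)
    (((measurable_deriv P).comp (hf.add (hh.const_mul 0))).mul hh).aestronglyMeasurable
    (Eventually.of_forall fun x t ht => ?_) (hbi.const_mul 2)
    (Eventually.of_forall fun x t _ => ?_)
  · simpa using key
  · have ht' : |t| ≤ 1 := abs_le.2 ht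
    have h0 : |t * h x| ≤ |h x| := by
      rw [abs_mul]; exact mul_le_of_le_one_left (abs_nonneg _) ht'
    refine (hP.abs_deriv_mul_le hdiff _ _).trans ?_
    rw [two_mul]
    have hnn : 0 ≤ |f x| + 2 * |h x| := by positivity
    refine add_le_add (hY.map_le_of_abs_le ?_) (hY.map_le_of_abs_le ?_)
    · rw [abs_of_nonneg hnn]
      linarith [abs_add_le (f x + t * h x) (h x), abs_add_le (f x) (t * h x)]
    · rw [abs_of_nonneg hnn]
      linarith [abs_sub (f x + t * h x) (h x), abs_add_le (f x) (t * h x)]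
  · have h1 : HasDerivAt (fun t : ℝ => f x + t * h x) (h x) t := by
      simpa using ((hasDerivAt_id t).mul_const (h x)).const_add (f x)
    exact (hdiff (f x + t * h x)).hasDerivAt.comp t h1

end IsNFunction

/-! ### Uniform convexity and the direct method. -/

/-- Either `u` and `v` are `ε`-separated, and the midpoint defect divided by `ρ` dominates the whole
average, or they are relatively close and convexity yields the term with `ε`. -/
theorem IsYoungFunction.map_half_sub_le {R : ℝ → ℝ} (hR : IsYoungFunction R) {ε ρ : ℝ}
    (hε : 0 < ε) (hε1 : ε ≤ 1) (hρ : 0 < ρ)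
    (h : ∀ u v : ℝ, ε * (|u| + |v|) ≤ |u - v| →
      ρ * ((R u + R v) / 2) ≤ (R u + R v) / 2 - R ((u + v) / 2)) (u v : ℝ) :
    R ((u - v) / 2) ≤ ((R u + R v) / 2 - R ((u + v) / 2)) / ρ + ε * ((R u + R v) / 2) := by
  have hu := hR.nonneg u
  have hv := hR.nonneg v
  have hD := hR.map_half_add_le u v
  rcases le_or_gt (ε * (|u| + |v|)) |u - v| with hc | hc
  · have h1 := hR.map_half_add_le u (-v)
    rw [hR.even v, ← sub_eq_add_neg] at h1
    have h2 : (R u + R v) / 2 ≤ ((R u + R v) / 2 - R ((u + v) / 2)) / ρ := by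
      rw [le_div_iff₀' hρ]; exact h u v hc
    have : 0 ≤ ε * ((R u + R v) / 2) := by positivity
    linarith
  · have h1 : R ((u - v) / 2) ≤ R (ε * ((|u| + |v|) / 2)) := by
      refine hR.map_le_of_abs_le ?_
      rw [abs_div, abs_two, abs_of_nonneg (by positivity : 0 ≤ ε * ((|u| + |v|) / 2))]
      linarith
    have h2 := hR.map_mul_le hε.le hε1 ((|u| + |v|) / 2)
    have h3 := hR.map_half_add_le |u| |v|
    rw [hR.map_abs, hR.map_abs] at h3
    have h4 : 0 ≤ ((R u + R v) / 2 - R ((u + v) / 2)) / ρ := div_nonneg (by linarith) hρ.le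
    have h5 := mul_le_mul_of_nonneg_left h3 hε.le
    linarith

namespace LuxemburgSpace

variable {P : ℝ → ℝ} (hP : IsNFunction P)
  (hfin : ∀ f : LuxemburgSpace P μ, modular P μ f < ⊤)
include hP hfin

theorem integrable_comp (f : LuxemburgSpace P μ) : Integrable (fun x => P (f x)) μ :=
  (hP.isYoungFunction.integrable_comp_iff f.measurable).2 (hfin f)

omit hfin in
theorem integral_comp_nonneg (f : LuxemburgSpace P μ) : 0 ≤ ∫ x, P (f x) ∂μ :=
  integral_nonneg fun _ => hP.isYoungFunction.nonneg _

/-- A functional bounded for the Luxemburg norm is dominated by half of the modular. -/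
theorem exists_le_integral_div_two_add
    (hconv : ∀ ε : ℝ, 0 < ε → ∃ ρ : ℝ, 0 < ρ ∧ ∀ u v : ℝ, ε * (|u| + |v|) ≤ |u - v| →
      ρ * ((P u + P v) / 2) ≤ (P u + P v) / 2 - P ((u + v) / 2))
    {φ : LuxemburgSpace P μ → ℝ} {C : ℝ} (hC : 0 < C) (hφ : ∀ f, |φ f| ≤ C * ‖f‖) :
    ∃ B : ℝ, 0 ≤ B ∧ ∀ f, φ f ≤ (∫ x, P (f x) ∂μ) / 2 + B := by
  have hY := hP.isYoungFunction
  -- For `s₀ ≤ k < ‖f‖` the modular of `k⁻¹ * f` exceeds `1`, so superlinearity gives `∫ P(f) ≥ 2 *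
  -- C * k`. The factor `2 * C` leaves half of the modular to spare.
  obtain ⟨s₀, hs₀, hs⟩ := hP.superlinear hconv (2 * C)
  refine ⟨C * s₀, by positivity, fun f => ((le_abs_self _).trans (hφ f)).trans ?_⟩
  have hI := integral_comp_nonneg hP f
  rcases le_or_gt ‖f‖ s₀ with h | h
  · have := mul_le_mul_of_nonneg_left h hC.le
    linarith
  · have h1 : ‖f‖ ≤ (∫ x, P (f x) ∂μ) / (2 * C) := by
      refine le_of_forall_lt_imp_le_of_dense fun a ha => (le_max_left a s₀).trans ?_
      have hk : max a s₀ < ‖f‖ := max_lt ha h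
      have hsk : s₀ ≤ max a s₀ := le_max_right _ _
      set k := max a s₀
      have hk0 : 0 < k := by linarith
      have h2 : 1 < modular P μ (fun x => k⁻¹ * f x) := by
        by_contra! hle
        exact hk.not_ge (norm_le_of_modular_le hk0 hle)
      have hm : Measurable fun x => k⁻¹ * f x := f.measurable.const_mul _
      have hlt : modular P μ (fun x => k⁻¹ * f x) < ⊤ := by
        refine (hY.modular_mono fun x => ?_).trans_lt (hfin f)
        rw [abs_mul, abs_of_pos (inv_pos.2 hk0)]
        exact mul_le_of_le_one_left (abs_nonneg _) (inv_le_one_of_one_le₀ (hs₀.trans hsk))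
      rw [hY.modular_eq_ofReal_integral hm hlt, ENNReal.one_lt_ofReal] at h2
      rw [le_div_iff₀ (by positivity)]
      calc k * (2 * C) ≤ 2 * C * k * ∫ x, P (k⁻¹ * f x) ∂μ := by
            rw [mul_comm]; exact le_mul_of_one_le_right (by positivity) h2.le
        _ = ∫ x, 2 * C * k * P (k⁻¹ * f x) ∂μ := (integral_const_mul _ _).symm
        _ ≤ ∫ x, P (f x) ∂μ := by
          refine integral_mono (((hY.integrable_comp_iff hm).2 hlt).const_mul _)
            (integrable_comp hP hfin f) fun x => ?_
          have := hs k hsk (k⁻¹ * f x)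
          rwa [mul_inv_cancel_left₀ hk0.ne'] at this
    rw [le_div_iff₀ (by positivity)] at h1
    have : 0 ≤ C * s₀ := by positivity
    linarith

variable {α : ℝ} (hα : 4 ≤ α) (hd : ∀ u, P (2 * u) ≤ α * P u)
include hα hd

omit hfin in
-- Doubling turns modular convergence into norm convergence: modular at most `α ^ (-j)` forces norm
-- at most `2 ^ (-j)`.
theorem tendsto_of_modular_tendsto {φ : LuxemburgSpace P μ →ₗ[ℝ] ℝ} {C : ℝ} (hC : 0 < C)
    (hφ : ∀ f, |φ f| ≤ C * ‖f‖) {u : ℕ → LuxemburgSpace P μ} {f : LuxemburgSpace P μ}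
    (h : Tendsto (fun n => modular P μ (fun x => f x - u n x)) atTop (𝓝 0)) :
    Tendsto (fun n => φ (u n)) atTop (𝓝 (φ f)) := by
  have hα0 : 0 < α := by linarith
  rw [Metric.tendsto_atTop]
  intro ε hε
  obtain ⟨j, hj⟩ := exists_pow_lt_of_lt_one (div_pos hε hC) (one_half_lt_one (α := ℝ))
  obtain ⟨N, hN⟩ := (ENNReal.tendsto_atTop_zero.1 h) (ENNReal.ofReal ((1 / α) ^ j))
    (ENNReal.ofReal_pos.2 (by positivity))
  refine ⟨N, fun n hn => ?_⟩
  have hnorm : ‖u n - f‖ ≤ (1 / 2) ^ j := by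
    refine norm_le_of_modular_le (by positivity) ?_
    have e : (fun x => ((1 / 2 : ℝ) ^ j)⁻¹ * (u n - f : LuxemburgSpace P μ) x)
        =ᵐ[μ] fun x => -(2 ^ j * (f x - u n x)) := by
      have h1 : ((u n - f : LuxemburgSpace P μ) : Ω → ℝ) =ᵐ[μ] fun x => u n x - f x :=
        AEEqFun.coeFn_sub _ _
      filter_upwards [h1] with x hx
      rw [hx, one_div, inv_pow, inv_inv]
      ring
    rw [modular_congr_ae e, hP.isYoungFunction.modular_neg]
    refine (IsYoungFunction.modular_two_pow_mul_le hα hd j _).trans ?_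
    refine (mul_le_mul_right (hN n hn) _).trans_eq ?_
    rw [← ENNReal.ofReal_mul (by positivity), ← mul_pow, mul_one_div_cancel hα0.ne', one_pow,
      ENNReal.ofReal_one]
  rw [Real.dist_eq, ← map_sub]
  calc |φ (u n - f)| ≤ C * ‖u n - f‖ := hφ _
    _ ≤ C * (1 / 2) ^ j := by gcongr
    _ < ε := by rwa [lt_div_iff₀' hC] at hj

/-- The direct method: `f ↦ ∫ P(f) dμ - φ f` attains its minimum. -/
theorem exists_isMinOn
    (hconv : ∀ ε : ℝ, 0 < ε → ∃ ρ : ℝ, 0 < ρ ∧ ∀ u v : ℝ, ε * (|u| + |v|) ≤ |u - v| →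
      ρ * ((P u + P v) / 2) ≤ (P u + P v) / 2 - P ((u + v) / 2))
    {φ : LuxemburgSpace P μ →ₗ[ℝ] ℝ} {C : ℝ} (hC : 0 < C) (hφ : ∀ f, |φ f| ≤ C * ‖f‖) :
    ∃ f : LuxemburgSpace P μ, ∀ h : LuxemburgSpace P μ,
      ∫ x, P (f x) ∂μ - φ f ≤ ∫ x, P (h x) ∂μ - φ h := by
  have hY := hP.isYoungFunction
  have hα0 : 0 < α := by linarith
  obtain ⟨B, hB0, hB⟩ := exists_le_integral_div_two_add hP hfin hconv hC hφ
  set J : LuxemburgSpace P μ → ℝ := fun f => ∫ x, P (f x) ∂μ - φ f with hJ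
  have hbdd : BddBelow (Set.range J) := ⟨-B, by
    rintro _ ⟨f, rfl⟩
    have := hB f
    have := integral_comp_nonneg hP f
    simp only [hJ]
    linarith⟩
  set m := ⨅ f, J f with hm
  have hmle : ∀ f, m ≤ J f := fun f => ciInf_le hbdd f
  have hseq : ∀ n : ℕ, ∃ f, J f < m + 1 / (n + 1) := fun n =>
    exists_lt_of_ciInf_lt (lt_add_of_pos_right m (by positivity))
  choose u hu using hseq
  -- From `∫ P(u n) / 2 - B ≤ J (u n) < m + 1`.
  set M := 2 * (m + 1 + B) with hMdef
  have hM : ∀ n, ∫ x, P (u n x) ∂μ ≤ M := fun n => by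
    have h1 := hB (u n)
    have h2 := hu n
    have h3 : (1 : ℝ) / (n + 1) ≤ 1 := by
      rw [div_le_one (by positivity)]; linarith [(Nat.cast_nonneg n : (0 : ℝ) ≤ n)]
    simp only [hJ] at h2
    linarith
  have hM0 : 0 ≤ M := (integral_comp_nonneg hP (u 0)).trans (hM 0)
  -- The midpoint of `u n` and `u k` has `J ≥ m`, and the linear part `φ` cancels, so the integrated
  -- convexity defect is at most the error of the minimising sequence.
  have hdefect : ∀ N n k : ℕ, N ≤ n → N ≤ k →
      Integrable (fun x => (P (u n x) + P (u k x)) / 2 - P ((u n x + u k x) / 2)) μ ∧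
      ∫ x, ((P (u n x) + P (u k x)) / 2 - P ((u n x + u k x) / 2)) ∂μ ≤ 1 / (N + 1) := by
    intro N n k hn hk
    have e : (((1 / 2 : ℝ) • (u n + u k) : LuxemburgSpace P μ) : Ω → ℝ)
        =ᵐ[μ] fun x => (u n x + u k x) / 2 := by
      filter_upwards [coe_smul (1 / 2 : ℝ) (u n + u k), coe_add (u n) (u k)] with x h1 h2
      rw [h1, h2]
      ring
    have e' : (fun x => P (((1 / 2 : ℝ) • (u n + u k) : LuxemburgSpace P μ) x))
        =ᵐ[μ] fun x => P ((u n x + u k x) / 2) := e.mono fun x hx => by simp only [hx]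
    have i1 := (integrable_comp hP hfin ((1 / 2 : ℝ) • (u n + u k))).congr e'
    have i2 : Integrable (fun x => (P (u n x) + P (u k x)) / 2) μ :=
      ((integrable_comp hP hfin (u n)).add (integrable_comp hP hfin (u k))).div_const 2
    refine ⟨i2.sub i1, ?_⟩
    have h1 := hmle ((1 / 2 : ℝ) • (u n + u k))
    simp only [hJ] at h1
    rw [integral_congr_ae e', map_smul, map_add, smul_eq_mul] at h1
    have hs : ∫ x, ((P (u n x) + P (u k x)) / 2 - P ((u n x + u k x) / 2)) ∂μ
        = (∫ x, P (u n x) ∂μ + ∫ x, P (u k x) ∂μ) / 2 - ∫ x, P ((u n x + u k x) / 2) ∂μ := by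
      rw [← integral_add (integrable_comp hP hfin _) (integrable_comp hP hfin _),
        ← integral_div]
      exact integral_sub i2 i1
    rw [hs]
    have h2 := hu n
    have h3 := hu k
    simp only [hJ] at h2 h3
    have h4 : (1 : ℝ) / (n + 1) ≤ 1 / (N + 1) := by gcongr
    have h5 : (1 : ℝ) / (k + 1) ≤ 1 / (N + 1) := by gcongr
    linarith
  have hcauchy : ∀ δ : ENNReal, 0 < δ → ∃ N, ∀ n ≥ N, ∀ k ≥ N,
      modular P μ (fun x => u n x - u k x) ≤ δ := by
    intro δ' hδ'
    obtain ⟨δ, hδ, hδδ'⟩ : ∃ δ : ℝ, 0 < δ ∧ ENNReal.ofReal δ ≤ δ' := by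
      obtain ⟨r, hr0, hr⟩ := ENNReal.lt_iff_exists_nnreal_btwn.1 hδ'
      exact ⟨r, by exact_mod_cast hr0, by rw [ENNReal.ofReal_coe_nnreal]; exact hr.le⟩
    -- Here `ε` makes the close-points term at most `δ / 2`, and `N`, chosen after `ρ`, does the
    -- same for the defect term. `M + 1` avoids division by zero.
    set ε := min 1 (δ / (2 * α * (M + 1))) with hε
    have hε0 : 0 < ε := lt_min one_pos (by positivity)
    obtain ⟨ρ, hρ, hερ⟩ := hconv ε hε0
    obtain ⟨N, hN⟩ := exists_nat_one_div_lt (show 0 < δ * ρ / (2 * α) by positivity)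
    refine ⟨N, fun n hn k hk => le_trans ?_ hδδ'⟩
    obtain ⟨hi, hle⟩ := hdefect N n k hn hk
    have i2 : Integrable (fun x => (P (u n x) + P (u k x)) / 2) μ :=
      ((integrable_comp hP hfin (u n)).add (integrable_comp hP hfin (u k))).div_const 2
    have hmaj : Integrable (fun x => α * (((P (u n x) + P (u k x)) / 2
        - P ((u n x + u k x) / 2)) / ρ + ε * ((P (u n x) + P (u k x)) / 2))) μ :=
      ((hi.div_const ρ).add (i2.const_mul ε)).const_mul α
    have hpt : ∀ x, P (u n x - u k x) ≤ α * (((P (u n x) + P (u k x)) / 2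
        - P ((u n x + u k x) / 2)) / ρ + ε * ((P (u n x) + P (u k x)) / 2)) := fun x => by
      have h1 := hd ((u n x - u k x) / 2)
      rw [mul_div_cancel₀ _ two_ne_zero] at h1
      refine h1.trans ?_
      gcongr
      exact hY.map_half_sub_le hε0 (min_le_left _ _) hρ hερ _ _
    refine (lintegral_mono fun x => ENNReal.ofReal_le_ofReal (hpt x)).trans ?_
    rw [← ofReal_integral_eq_lintegral_ofReal hmaj
      (Eventually.of_forall fun x => (hY.nonneg _).trans (hpt x))]
    refine ENNReal.ofReal_le_ofReal ?_
    have hsum : ∫ x, (P (u n x) + P (u k x)) / 2 ∂μ ≤ M := by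
      rw [integral_div, integral_add (integrable_comp hP hfin _) (integrable_comp hP hfin _)]
      linarith [hM n, hM k]
    rw [integral_const_mul, integral_add (hi.div_const ρ) (i2.const_mul ε), integral_div,
      integral_const_mul]
    have hε2 : ε * (2 * α * (M + 1)) ≤ δ := by
      rw [← le_div_iff₀ (by positivity)]; exact min_le_right _ _
    have hN' : 1 / ((N : ℝ) + 1) / ρ ≤ δ / (2 * α) := by
      rw [div_le_iff₀ hρ]
      refine hN.le.trans_eq ?_
      ring
    calc _ ≤ α * (1 / ((N : ℝ) + 1) / ρ + ε * M) := by gcongr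
      _ ≤ α * (δ / (2 * α) + ε * M) := by gcongr
      _ = δ / 2 + ε * α * M := by field_simp
      _ ≤ δ := by
        have : 0 ≤ ε * α := by positivity
        linarith
  obtain ⟨F, hF, ⟨ns, hns, hae⟩, hlim⟩ := hY.exists_tendsto_of_modular_cauchy hα hd
    (fun n => (u n).measurable) hcauchy
  have hFfin : modular P μ F < ⊤ := by
    obtain ⟨n, hn⟩ := (hlim.eventually_lt_const ENNReal.zero_lt_top).exists
    have := hY.modular_add_lt_top hα hd (hF.sub (u n).measurable) hn (hfin (u n))
    simpa using this
  obtain ⟨f, hf⟩ := exists_coe_eq hP hF hFfin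
  have hlim' : Tendsto (fun n => modular P μ (fun x => f x - u n x)) atTop (𝓝 0) := by
    refine hlim.congr fun n => modular_congr_ae (hf.mono fun x hx => ?_)
    simp only [hx]
  have hφlim := tendsto_of_modular_tendsto hP hα hd hC hφ hlim'
  refine ⟨f, fun h => le_trans ?_ (hmle h)⟩
  have hJlim : Tendsto (fun n => J (u n)) atTop (𝓝 m) := by
    refine tendsto_of_tendsto_of_tendsto_of_le_of_le tendsto_const_nhds
      (h := fun n : ℕ => m + 1 / ((n : ℝ) + 1)) ?_ (fun n => hmle _) fun n => (hu n).le
    simpa using tendsto_one_div_add_atTop_nhds_zero_nat.const_add m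
  have hIlim : Tendsto (fun n => ∫ x, P (u n x) ∂μ) atTop (𝓝 (m + φ f)) :=
    (hJlim.add hφlim).congr fun n => by simp only [hJ]; ring
  have h0 : 0 ≤ m + φ f := ge_of_tendsto' hIlim fun n => integral_comp_nonneg hP (u n)
  -- Lower semicontinuity: `∫ P(u n)` tends to `m + φ f`, so Fatou along the almost everywhere
  -- convergent subsequence gives `J f ≤ m`.
  have hfatou : modular P μ f ≤ ENNReal.ofReal (m + φ f) := by
    rw [modular_congr_ae hf]
    refine (hY.modular_le_liminf (fun k => (u (ns k)).measurable) hae).trans_eq ?_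
    refine Tendsto.liminf_eq ?_
    refine (ENNReal.tendsto_ofReal (hIlim.comp hns.tendsto_atTop)).congr fun k => ?_
    exact (hY.modular_eq_ofReal_integral (u (ns k)).measurable (hfin _)).symm
  rw [hY.modular_eq_ofReal_integral f.measurable (hfin f), ENNReal.ofReal_le_ofReal_iff h0]
    at hfatou
  linarith

/-- Every functional bounded for the Luxemburg norm is given by a function in the conjugate
space. -/
theorem exists_eq_integral_mul (hdiff : Differentiable ℝ P)
    (hconv : ∀ ε : ℝ, 0 < ε → ∃ ρ : ℝ, 0 < ρ ∧ ∀ u v : ℝ, ε * (|u| + |v|) ≤ |u - v| →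
      ρ * ((P u + P v) / 2) ≤ (P u + P v) / 2 - P ((u + v) / 2))
    {φ : LuxemburgSpace P μ →ₗ[ℝ] ℝ} {C : ℝ} (hC : 0 < C) (hφ : ∀ f, |φ f| ≤ C * ‖f‖) :
    ∃ g : ConjugateOrliczSpace P μ, ∀ h : LuxemburgSpace P μ, φ h = ∫ x, h x * g x ∂μ := by
  obtain ⟨f, hf⟩ := exists_isMinOn hP hfin hα hd hconv hC hφ
  -- The representing function is `P'(f)`; membership in `L^Q` is the integrability half of the
  -- Gateaux derivative.
  obtain ⟨g, hg⟩ := ConjugateOrliczSpace.exists_coe_eq (P := P) (μ := μ)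
    (g := fun x => deriv P (f x)) ((measurable_deriv P).comp f.measurable) fun h hh hhm =>
      ((hP.hasDerivAt_integral_comp hdiff hα hd f.measurable hh (hfin f) hhm).1).congr
        (Eventually.of_forall fun x => mul_comm _ _)
  refine ⟨g, fun h => ?_⟩
  have hder := (hP.hasDerivAt_integral_comp hdiff hα hd f.measurable h.measurable
    (hfin f) (hfin h)).2
  have hder' : HasDerivAt (fun t : ℝ => ∫ x, P (f x + t * h x) ∂μ - (φ f + t * φ h))
      (∫ x, deriv P (f x) * h x ∂μ - φ h) 0 := by
    refine hder.sub ?_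
    simpa using ((hasDerivAt_id (0 : ℝ)).mul_const (φ h)).const_add (φ f)
  -- The Euler–Lagrange equation: `J` restricted to the line `f + t h` is minimal at `t = 0`.
  have hmin : IsLocalMin (fun t : ℝ => ∫ x, P (f x + t * h x) ∂μ - (φ f + t * φ h)) 0 := by
    refine Eventually.of_forall fun t => ?_
    have h1 := hf (f + t • h)
    have e : ∫ x, P ((f + t • h : LuxemburgSpace P μ) x) ∂μ = ∫ x, P (f x + t * h x) ∂μ := by
      refine integral_congr_ae ?_
      filter_upwards [coe_add f (t • h), coe_smul t h] with x h1 h2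
      rw [h1, h2]
    rw [e, map_add, map_smul, smul_eq_mul] at h1
    simpa using h1
  have hz := hmin.hasDerivAt_eq_zero hder'
  rw [← sub_eq_zero.1 hz]
  refine integral_congr_ae (hg.mono fun x hx => ?_)
  simp only [hx]
  ring

end LuxemburgSpace

/-! ### The pairing and the duality theorem. -/

/-- A bilinear pairing that norms `F` and represents all functionals on `E` identifies `F` with
the dual of `E`. -/
theorem exists_linearIsometryEquiv_dual {E F : Type*} [NormedAddCommGroup E] [NormedSpace ℝ E]
    [NormedAddCommGroup F] [NormedSpace ℝ F] (B : F →ₗ[ℝ] E →ₗ[ℝ] ℝ)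
    (hle : ∀ g f, |B g f| ≤ ‖g‖ * ‖f‖)
    (hge : ∀ g M, (∀ f, ‖f‖ ≤ 1 → B g f ≤ M) → ‖g‖ ≤ M)
    (hsurj : ∀ φ : StrongDual ℝ E, ∃ g, ∀ f, φ f = B g f) :
    ∃ Φ : F ≃ₗᵢ[ℝ] StrongDual ℝ E, ∀ g f, Φ g f = B g f := by
  let T : F →ₗ[ℝ] StrongDual ℝ E :=
    { toFun := fun g => (B g).mkContinuous ‖g‖ (hle g)
      map_add' := fun g h => by ext f; simp
      map_smul' := fun c g => by ext f; simp }
  have hT : ∀ g f, T g f = B g f := fun g f => rfl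
  let I : F →ₗᵢ[ℝ] StrongDual ℝ E :=
    { T with
      norm_map' := fun g => by
        refine le_antisymm (LinearMap.mkContinuous_norm_le (B g) (norm_nonneg g) (hle g))
          (hge g _ fun f hf => ?_)
        rw [← hT]
        exact (le_abs_self _).trans (((T g).le_opNorm f).trans
          (mul_le_of_le_one_right (norm_nonneg _) hf)) }
  refine ⟨LinearIsometryEquiv.ofSurjective I fun φ => ?_, fun g f => rfl⟩
  obtain ⟨g, hg⟩ := hsurj φ
  exact ⟨g, ContinuousLinearMap.ext fun f => (hg f).symm⟩

variable {P : ℝ → ℝ}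

/-- Hölder's inequality for the Luxemburg and Orlicz norms. -/
theorem abs_integral_mul_le_norm_mul_norm (hP : IsNFunction P)
    (hfin : ∀ f : LuxemburgSpace P μ, modular P μ f < ⊤) (f : LuxemburgSpace P μ)
    (g : ConjugateOrliczSpace P μ) : |∫ x, f x * g x ∂μ| ≤ ‖g‖ * ‖f‖ := by
  have hg := ConjugateOrliczSpace.norm_nonneg hP g
  have h1 : ∀ k, ‖f‖ < k → |∫ x, f x * g x ∂μ| ≤ ‖g‖ * k := fun k hk => by
    have hk0 : 0 < k := (LuxemburgSpace.norm_nonneg f).trans_lt hk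
    have hm := LuxemburgSpace.modular_le_one_of_norm_lt hP hfin hk
    have e : ∫ x, (k⁻¹ * f x) * g x ∂μ = k⁻¹ * ∫ x, f x * g x ∂μ := by
      rw [← integral_const_mul]
      simp only [mul_assoc]
    have hp := ConjugateOrliczSpace.integral_mul_le_norm hP g (f.measurable.const_mul k⁻¹) hm
    have hn := ConjugateOrliczSpace.integral_mul_le_norm hP g (f.measurable.const_mul k⁻¹).neg
      ((hP.isYoungFunction.modular_neg _).trans_le hm)
    have e' : ∫ x, (-fun x => k⁻¹ * f x) x * g x ∂μ = -(k⁻¹ * ∫ x, f x * g x ∂μ) := by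
      rw [← e, ← integral_neg]
      exact integral_congr_ae (Eventually.of_forall fun x => by simp)
    rw [e, inv_mul_le_iff₀ hk0] at hp
    rw [e', ← mul_neg, inv_mul_le_iff₀ hk0] at hn
    rw [abs_le]
    constructor <;> linarith
  have hlim : Tendsto (fun k => ‖g‖ * k) (𝓝[>] ‖f‖) (𝓝 (‖g‖ * ‖f‖)) :=
    (tendsto_nhdsWithin_of_tendsto_nhds tendsto_id).const_mul _
  exact ge_of_tendsto hlim (eventually_mem_nhdsWithin.mono h1)

/-- The integral pairing of the conjugate Orlicz space with the Luxemburg space. -/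
noncomputable def orliczPairing (hfin : ∀ f : LuxemburgSpace P μ, modular P μ f < ⊤) :
    ConjugateOrliczSpace P μ →ₗ[ℝ] LuxemburgSpace P μ →ₗ[ℝ] ℝ :=
  have hi (g : ConjugateOrliczSpace P μ) (f : LuxemburgSpace P μ) :
      Integrable (fun x => f x * g x) μ := g.integrable_mul f.measurable (hfin f)
  LinearMap.mk₂ ℝ (fun g f => ∫ x, f x * g x ∂μ)
    (fun g₁ g₂ f => by
      rw [← integral_add (hi g₁ f) (hi g₂ f)]
      refine integral_congr_ae ((ConjugateOrliczSpace.coe_add g₁ g₂).mono fun x hx => ?_)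
      simp only [hx, mul_add])
    (fun c g f => by
      rw [smul_eq_mul, ← integral_const_mul]
      refine integral_congr_ae ((ConjugateOrliczSpace.coe_smul c g).mono fun x hx => ?_)
      simp only [hx, mul_left_comm])
    (fun g f₁ f₂ => by
      rw [← integral_add (hi g f₁) (hi g f₂)]
      refine integral_congr_ae ((LuxemburgSpace.coe_add f₁ f₂).mono fun x hx => ?_)
      simp only [hx, add_mul])
    (fun c g f => by
      rw [smul_eq_mul, ← integral_const_mul]
      refine integral_congr_ae ((LuxemburgSpace.coe_smul c f).mono fun x hx => ?_)
      simp only [hx, mul_assoc])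

end Modular

/-- The conclusion asserts that the Luxemburg and Orlicz norms are genuine norms on `L^P` and
`L^Q` (`NormedSpace.Core` lists the norm axioms; definiteness also rules out that the real `sInf`
or `sSup` defining the norm of a nonzero element takes its default value `0`), that `f * g` is
always integrable, and that `g ↦ (f ↦ ∫ f g)` is a surjective linear isometry of `L^Q` onto the
dual of `L^P` with the operator norm. -/
theorem theorem10 {Ω : Type*} [MeasurableSpace Ω] (μ : Measure Ω) (hμ : IsSemifinite μ)
    (P : ℝ → ℝ) (hP : IsNFunction P) (hdiff : Differentiable ℝ P)
    (hdouble : ∃ α : ℝ, ∀ u : ℝ, P (2 * u) ≤ α * P u)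
    (hconv : ∀ ε : ℝ, 0 < ε → ∃ ρ : ℝ, 0 < ρ ∧ ∀ u v : ℝ, ε * (|u| + |v|) ≤ |u - v| →
      ρ * ((P u + P v) / 2) ≤ (P u + P v) / 2 - P ((u + v) / 2)) :
    ∃ (coreP : NormedSpace.Core ℝ (LuxemburgSpace P μ))
      (coreQ : NormedSpace.Core ℝ (ConjugateOrliczSpace P μ)),
      letI : NormedAddCommGroup (LuxemburgSpace P μ) := NormedAddCommGroup.ofCore coreP
      letI : NormedSpace ℝ (LuxemburgSpace P μ) := NormedSpace.ofCore coreP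
      letI : NormedAddCommGroup (ConjugateOrliczSpace P μ) := NormedAddCommGroup.ofCore coreQ
      letI : NormedSpace ℝ (ConjugateOrliczSpace P μ) := NormedSpace.ofCore coreQ
      (∀ (f : LuxemburgSpace P μ) (g : ConjugateOrliczSpace P μ),
        Integrable (fun x => f x * g x) μ) ∧
      ∃ Φ : ConjugateOrliczSpace P μ ≃ₗᵢ[ℝ] StrongDual ℝ (LuxemburgSpace P μ),
        ∀ (g : ConjugateOrliczSpace P μ) (f : LuxemburgSpace P μ),
          Φ g f = ∫ x, f x * g x ∂μ := by
  obtain ⟨α₀, hα₀⟩ := hdouble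
  -- As `P ≥ 0`, the doubling constant may be enlarged; `α ≥ 4` makes it positive with increasing
  -- powers.
  obtain ⟨α, hα, hd⟩ : ∃ α : ℝ, 4 ≤ α ∧ ∀ u, P (2 * u) ≤ α * P u :=
    ⟨max α₀ 4, le_max_right _ _, fun u => (hα₀ u).trans
      (mul_le_mul_of_nonneg_right (le_max_left _ _) (hP.isYoungFunction.nonneg u))⟩
  have hfin : ∀ f : LuxemburgSpace P μ, modular P μ f < ⊤ := fun f =>
    hP.modular_lt_top_of_integrable_mul hμ hdiff hα hd f.measurable f.2
  have coreP := LuxemburgSpace.normCore hP hfin hα hd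
  have coreQ := ConjugateOrliczSpace.normCore hP hμ
  refine ⟨coreP, coreQ, ?_⟩
  let : NormedAddCommGroup (LuxemburgSpace P μ) := NormedAddCommGroup.ofCore coreP
  let : NormedSpace ℝ (LuxemburgSpace P μ) := NormedSpace.ofCore coreP
  let : NormedAddCommGroup (ConjugateOrliczSpace P μ) := NormedAddCommGroup.ofCore coreQ
  let : NormedSpace ℝ (ConjugateOrliczSpace P μ) := NormedSpace.ofCore coreQ
  refine ⟨fun f g => g.integrable_mul f.measurable (hfin f), ?_⟩
  refine exists_linearIsometryEquiv_dual (orliczPairing hfin)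
    (fun g f => abs_integral_mul_le_norm_mul_norm hP hfin f g) (fun g M hM => ?_) fun φ => ?_
  -- Every function competing in the Orlicz norm has Luxemburg norm at most `1`, so the dual norm
  -- dominates the Orlicz norm.
  · refine ConjugateOrliczSpace.norm_le hP fun f hf hfm => ?_
    obtain ⟨F, hF⟩ := LuxemburgSpace.exists_coe_eq hP hf (hfm.trans_lt ENNReal.one_lt_top)
    have hF1 : ‖F‖ ≤ 1 := by
      refine LuxemburgSpace.norm_le_of_modular_le one_pos ?_
      simpa only [inv_one, one_mul, modular_congr_ae hF] using hfm
    refine le_trans (le_of_eq ?_) (hM F hF1)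
    exact integral_congr_ae (hF.mono fun x hx => by simp only [hx])
  · refine LuxemburgSpace.exists_eq_integral_mul hP hfin hα hd hdiff hconv
      (φ := φ.toLinearMap) (C := ‖φ‖ + 1) (by positivity) fun f => ?_
    refine (φ.le_opNorm f).trans ?_
    have : 0 ≤ ‖f‖ := norm_nonneg f
    change ‖φ‖ * ‖f‖ ≤ (‖φ‖ + 1) * ‖f‖
    linarith
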